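/- Let $(\xi_j,A_j,B_j,\eta_j)$, $j=1,2$, be two linear representations of sizes $m_1,m_2$ with nonnegative real entries ($\xi_j,\eta_j\in\mathbb R_+^{m_j}$, $A_j,B_j\in\mathbb R_+^{m_j\times m_j}$), such that $M_j=A_j+B_j$ is irreducible with Perron--Frobenius eigenvalue $\lambda_j$ and $\xi_j\neq 0\neq\eta_j$ for $j=1,2$. Put $$\xi=\begin{pmatrix}\xi_1\\ \xi_2\end{pmatrix},\quad A=\begin{pmatrix}A_1&0\\0&A_2\end{pmatrix},\quad B=\begin{pmatrix}B_1&0\\0&B_2\end{pmatrix},\quad \eta=\begin{pmatrix}\eta_1\\ \eta_2\end{pmatrix},$$ let $\mu:\{a,b\}^*\to\mathbb R_+^{m\times m}$, $m=m_1+m_2$, be the monoid morphism with $\mu(a)=A$, $\mu(b)=B$, and let $(r,w)=\xi'\mu(w)\eta$. Assume that $A\neq 0\neq B$ and that for every $n\ge 1$ some word $w$ of length $n$ has $(r,w)>0$. Let $Y_n=|w|_a$ be the number of occurrences of $a$ in a word $w\in\{a,b\}^n$ chosen at random with probability $\Pr(w)=(r,w)/\sum_{x\in\{a,b\}^n}(r,x)$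 (a sum model). Assume that $\lambda_1>\lambda_2$, that $M_1$ is primitive (some power has only positive entries), and that the pair $(A_1,B_1)$ is aperiodic: in the directed graph on $\{1,\dots,m_1\}$ that has an edge $i\to j$ labelled $a$ (respectively $b$) whenever $(A_1)_{ij}>0$ (respectively $(B_1)_{ij}>0$), the greatest common divisor of all differences $|\ell(\mathcal C)|_a-|\ell(\mathcal C')|_a$ is $1$, where $\mathcal C,\mathcal C'$ range over the pairs of cycles (closed paths) of equal length and $\ell(\mathcal C)$ is the word read along $\mathcal C$. Let $u_1(z)$ be the function analytic near $z=0$ (it exists, and its germ at $0$ determines the constants below) implicitly defined by $\det(u_1(z)I-A_1e^z-B_1)=0$ and $u_1(0)=\lambda_1$, and put $$\beta_1=\frac{u_1'(0)}{\lambda_1},\qquad \gamma_1=\frac{u_1''(0)}{\lambda_1}-\left(\frac{u_1'(0)}{\lambda_1}\right)^2 .$$ Then $\beta_1$ and $\gamma_1$ are real, $0<\beta_1<1$, $\gamma_1>0$, and, as $n\to+\infty$, $$\left|\sqrt n\,\Pr(Y_n=k)-\frac{e^{-\frac{(k-\beta_1n)^2}{2\gamma_1n}}}{\sqrt{2\pi\gamma_1}}\right|=O\!\left(n^{-1/2}\right)$$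 uniformly for $k\in\{0,1,\dots,n\}$. -/

import Mathlib

open Filter Topology Matrix

namespace SymbolStat

/-- The binary alphabet `{a, b}`. -/
inductive Letter where
  | a : Letter
  | b : Letter
  deriving DecidableEq

instance : Fintype Letter :=
  ⟨{Letter.a, Letter.b}, fun x => by cases x <;> simp⟩

/-- A linear representation `(ξ, A, B, η)` over the nonnegative reals, with state set `ι`
(its size is the cardinality of `ι`). -/
structure LinRep (ι : Type) where
  /-- initial weights -/
  ξ : ι → ℝ
  /-- weights of the transitions labelled `a` -/
  A : Matrix ι ι ℝ
  /-- weights of the transitions labelled `b` -/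
  B : Matrix ι ι ℝ
  /-- final weights -/
  η : ι → ℝ
  ξ_nonneg : ∀ i, 0 ≤ ξ i
  A_nonneg : ∀ i j, 0 ≤ A i j
  B_nonneg : ∀ i j, 0 ≤ B i j
  η_nonneg : ∀ i, 0 ≤ η i

namespace LinRep

section General

variable {ι : Type} (R : LinRep ι)

/-- The matrix of a letter: `A` for `a` and `B` for `b`. -/
def mat : Letter → Matrix ι ι ℝ
  | Letter.a => R.A
  | Letter.b => R.B

/-- The total transition matrix `M = A + B`. -/
def M : Matrix ι ι ℝ := R.A + R.B

/-- `R.IsLabelledPath i w j`: in the transition graph (an edge from `i` to `j` labelled `x` whenever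
the `(i, j)` entry of the matrix of `x` is positive) some path from `i` to `j` has label `w`. -/
inductive IsLabelledPath : ι → List Letter → ι → Prop
  | nil (i : ι) : IsLabelledPath i [] i
  | cons {i j k : ι} {w : List Letter} (x : Letter) (h : 0 < R.mat x i j)
      (p : IsLabelledPath j w k) : IsLabelledPath i (x :: w) k

/-- `w` is the label of a cycle (a closed path of positive length) of the transition graph. -/
def IsCycleLabel (w : List Letter) : Prop :=
  w ≠ [] ∧ ∃ i, R.IsLabelledPath i w i

/-- The differences of the numbers of `a` in the labels of two cycles of equal length. -/
def cycleDifferences : Set ℤ :=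
  {d | ∃ w₁ w₂ : List Letter, R.IsCycleLabel w₁ ∧ R.IsCycleLabel w₂ ∧ w₁.length = w₂.length ∧
    d = (w₁.count Letter.a : ℤ) - (w₂.count Letter.a : ℤ)}

/-- The pair `(A, B)` is aperiodic: the greatest common divisor of `cycleDifferences` is `1`, i.e.
`1` is the only natural number dividing all of them. -/
def IsAperiodicPair : Prop :=
  ∀ d : ℕ, (∀ x ∈ R.cycleDifferences, (d : ℤ) ∣ x) → d = 1

variable [Fintype ι] [DecidableEq ι]

/-- The monoid morphism `μ : {a,b}* → ℝ₊^{ι × ι}` with `μ(a) = A` and `μ(b) = B`. -/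
def morphism : FreeMonoid Letter →* Matrix ι ι ℝ := FreeMonoid.lift R.mat

/-- The formal series with this linear representation: `(r, w) = ξ' μ(w) η`. -/
def series (w : FreeMonoid Letter) : ℝ := R.ξ ⬝ᵥ (R.morphism w *ᵥ R.η)

end General

end LinRep

/-- A word of length `n` (given by its letters) as an element of the free monoid `{a,b}*`. -/
def word {n : ℕ} (w : Fin n → Letter) : FreeMonoid Letter := FreeMonoid.ofList (List.ofFn w)

/-- `|w|_a`, the number of occurrences of `a` in a word. -/
def countA {n : ℕ} (w : Fin n → Letter) : ℕ := (List.ofFn w).count Letter.a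

namespace LinRep

variable {ι : Type} [Fintype ι] [DecidableEq ι] (R : LinRep ι)

/-- The standing assumption: every length `n ≥ 1` has a word of positive weight (so the
distributions below are well defined), and both transition matrices are non-null. -/
def IsAdmissible : Prop :=
  (∀ n : ℕ, 1 ≤ n → ∃ w : Fin n → Letter, 0 < R.series (word w)) ∧ R.A ≠ 0 ∧ R.B ≠ 0

/-- The probability of a word of length `n`: its weight divided by the total weight of the words
of length `n`. -/
noncomputable def wordProb {n : ℕ} (w : Fin n → Letter) : ℝ :=
  R.series (word w) / ∑ x : Fin n → Letter, R.series (word x)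

/-- `Pr(Y_n = k)`, where `Y_n = |w|_a` for a random word `w` of length `n`. -/
noncomputable def prY (n k : ℕ) : ℝ :=
  ∑ w : Fin n → Letter with countA w = k, R.wordProb w

/-- The Perron-Frobenius eigenvalue of `M`: the maximal modulus of the complex eigenvalues
of `M`. -/
noncomputable def perronValue : ℝ :=
  (spectralRadius ℂ (R.M.map (algebraMap ℝ ℂ))).toReal

/-- `u` is the function (germ at `0`) implicitly defined by `det (u(z) I - A e^z - B) = 0` and
`u(0) = λ`, with `λ` the Perron-Frobenius eigenvalue of `A + B`. -/
structure IsPerronBranch (u : ℂ → ℂ) : Prop where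
  analyticAt : AnalyticAt ℂ u 0
  map_zero : u 0 = (R.perronValue : ℂ)
  det_eq_zero : ∀ᶠ z in 𝓝 (0 : ℂ),
    (u z • (1 : Matrix ι ι ℂ) - Complex.exp z • R.A.map (algebraMap ℝ ℂ)
      - R.B.map (algebraMap ℝ ℂ)).det = 0

end LinRep

/-- The bicomponent linear representation without communication
`ξ' = (ξ₁', ξ₂')`, `A = diag(A₁, A₂)`, `B = diag(B₁, B₂)`, `η = (η₁, η₂)`. -/
def LinRep.sum {ι₁ ι₂ : Type} (R₁ : LinRep ι₁) (R₂ : LinRep ι₂) : LinRep (ι₁ ⊕ ι₂) where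
  ξ := Sum.elim R₁.ξ R₂.ξ
  A := Matrix.fromBlocks R₁.A 0 0 R₂.A
  B := Matrix.fromBlocks R₁.B 0 0 R₂.B
  η := Sum.elim R₁.η R₂.η
  ξ_nonneg := by rintro (i | i) <;> simp [R₁.ξ_nonneg, R₂.ξ_nonneg]
  A_nonneg := by rintro (i | i) (j | j) <;> simp [R₁.A_nonneg, R₂.A_nonneg]
  B_nonneg := by rintro (i | i) (j | j) <;> simp [R₁.B_nonneg, R₂.B_nonneg]
  η_nonneg := by rintro (i | i) <;> simp [R₁.η_nonneg, R₂.η_nonneg]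

/-- `Y_n`, defined by `R₁.sum R₂`, is defined in a sum model: the standing assumption holds, both
components are irreducible, and all their initial and final weight vectors are non-null. -/
structure IsSumModel {ι₁ ι₂ : Type} [Fintype ι₁] [DecidableEq ι₁] [Fintype ι₂] [DecidableEq ι₂]
    (R₁ : LinRep ι₁) (R₂ : LinRep ι₂) : Prop where
  admissible : (R₁.sum R₂).IsAdmissible
  irreducible₁ : R₁.M.IsIrreducible
  irreducible₂ : R₂.M.IsIrreducible
  ξ₁_ne_zero : R₁.ξ ≠ 0
  η₁_ne_zero : R₁.η ≠ 0
  ξ₂_ne_zero : R₂.ξ ≠ 0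
  η₂_ne_zero : R₂.η ≠ 0

end SymbolStat

/-! The law of `Y_n` is read off its generating function `ξ'(A e^z + B)^n η`, whose values on the
imaginary axis give the weights by Fourier inversion. For the sum model this function is the sum of
those of the two components. After division by `λ₁^n` the second component is exponentially small,
because its spectral radius is below `λ₁`; only the first one matters.

The first component is conjugated by the diagonal of its right Perron vector and divided by `λ₁`.
This leaves the word probabilities and the labelled graph unchanged up to a factor `λ₁^{-n}` on
weights, and makes `M` a primitive stochastic matrix with stationary law `p`. The branch `u` becomes
`u/λ₁`, with value 1 at 0.

For such a chain three facts suffice. Near `θ = 0`, an analytic spectral projection gives `u(iθ)^n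
s(iθ)` plus an exponentially small error (`exists_bilin_twist_pow`). For `0 < |θ| ≤ π`, aperiodicity
and the equality case of the triangle inequality push the spectral radius below 1
(`spectralRadius_twist_lt_one`). Finally `u'(0) = β` and `u''(0) = γ + β²`, where `γ` is the
stationary mean square of a martingale increment; it is positive since otherwise the count of `a`
would be a coboundary (`exists_mean_variance`, `variance_pos`).

Together these bound the distance to the Gaussian characteristic function by `|θ| e^{-bnθ²}` plus an
exponentially small term (`exists_char_bound`). Integration costs `O(1/n)`, and the factor `√n`
leaves `O(n^{-1/2})` (`exists_local_limit_bound`). Dividing by the total weight, which converges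
exponentially fast to a positive constant, finishes the proof. -/

namespace SymbolStat

/-! ### Power bounds that are uniform in a parameter. -/

section PowerBounds

open scoped ENNReal NNReal

/-- Gelfand's formula yields one exponent `k` with `‖T x₀ ^ k‖ < 1`. For this fixed `k` the
inequality is open in `x`, and Euclidean division of `n` by `k` extends it to all powers, uniformly
in `x`. -/
theorem exists_pow_bound_of_spectralRadius_lt_one {X 𝔸 : Type*} [TopologicalSpace X]
    [NormedRing 𝔸] [NormedAlgebra ℂ 𝔸] [CompleteSpace 𝔸] {T : X → 𝔸} {x₀ : X}
    (hT : ContinuousAt T x₀) (h : spectralRadius ℂ (T x₀) < 1) :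
    ∃ C ρ : ℝ, 0 < ρ ∧ ρ < 1 ∧ 0 ≤ C ∧ ∀ᶠ x in 𝓝 x₀, ∀ n : ℕ, ‖T x ^ n‖ ≤ C * ρ ^ n := by
  have hG := (spectrum.pow_nnnorm_pow_one_div_tendsto_nhds_spectralRadius (T x₀)).eventually
    (gt_mem_nhds h)
  obtain ⟨k, hk, hk1⟩ := (hG.and (eventually_ge_atTop 1)).exists
  have hk0 : k ≠ 0 := by omega
  have hnorm : ‖T x₀ ^ k‖ < 1 := by
    by_contra hcon
    rw [not_lt] at hcon
    have h1 : (1 : ℝ≥0∞) ≤ (‖T x₀ ^ k‖₊ : ℝ≥0∞) := by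
      exact_mod_cast hcon
    exact absurd hk (not_lt.mpr (ENNReal.one_le_rpow h1 (by positivity)))
  obtain ⟨r, hr, hr1⟩ := exists_between hnorm
  have hr0 : 0 < r := (norm_nonneg _).trans_lt hr
  have hk' : (k : ℝ) ≠ 0 := by exact_mod_cast hk0
  set ρ : ℝ := r ^ (1 / (k : ℝ)) with hρ
  have hρ0 : 0 < ρ := Real.rpow_pos_of_pos hr0 _
  have hρk : ρ ^ k = r := by
    rw [hρ, ← Real.rpow_natCast, ← Real.rpow_mul hr0.le, one_div_mul_cancel hk', Real.rpow_one]
  have hρ1 : ρ < 1 := Real.rpow_lt_one hr0.le hr1 (by positivity)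
  set D : ℝ := ‖T x₀‖ + 1 with hD
  have hD1 : 1 ≤ D := by linarith [norm_nonneg (T x₀)]
  -- `‖1‖ + 1` covers the zeroth power, as the norm of 1 need not be 1; `D ^ k` bounds the remainder
  -- `n % k`; `1 / r` pays for rounding `n` up to a multiple of `k`.
  refine ⟨(‖(1 : 𝔸)‖ + 1) * D ^ k / r, ρ, hρ0, hρ1, by positivity, ?_⟩
  filter_upwards [(hT.pow k).norm.eventually (gt_mem_nhds hr),
    hT.norm.eventually (gt_mem_nhds (show ‖T x₀‖ < D by linarith))] with x hx hx' n
  have hpow : ∀ q : ℕ, ‖(T x ^ k) ^ q‖ ≤ (‖(1 : 𝔸)‖ + 1) * r ^ q := by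
    intro q
    rcases Nat.eq_zero_or_pos q with rfl | hq
    · simp
    · calc ‖(T x ^ k) ^ q‖ ≤ ‖T x ^ k‖ ^ q := norm_pow_le' _ hq
        _ ≤ r ^ q := pow_le_pow_left₀ (norm_nonneg _) hx.le _
        _ ≤ _ := le_mul_of_one_le_left (by positivity) (by linarith [norm_nonneg (1 : 𝔸)])
  have hn : T x ^ n = (T x ^ k) ^ (n / k) * T x ^ (n % k) := by
    rw [← pow_mul, ← pow_add, Nat.div_add_mod]
  have hs : n % k ≤ k := (Nat.mod_lt _ (by omega)).le
  have hρn : r ^ (n / k) * r ≤ ρ ^ n := by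
    calc r ^ (n / k) * r = ρ ^ (k * (n / k) + k) := by rw [pow_add, pow_mul, hρk]
      _ ≤ ρ ^ n := by
        apply pow_le_pow_of_le_one hρ0.le hρ1.le
        conv_lhs => rw [← Nat.div_add_mod n k]
        omega
  have hmain : ‖T x ^ n‖ ≤ (‖(1 : 𝔸)‖ + 1) * r ^ (n / k) * D ^ k := by
    rcases Nat.eq_zero_or_pos (n % k) with h0 | h0
    · rw [hn, h0, pow_zero, mul_one]
      exact (hpow _).trans (le_mul_of_one_le_right (by positivity) (one_le_pow₀ hD1))
    · rw [hn]
      refine (norm_mul_le _ _).trans (mul_le_mul (hpow _) ?_ (norm_nonneg _) (by positivity))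
      exact (norm_pow_le' _ h0).trans ((pow_le_pow_left₀ (norm_nonneg _) hx'.le _).trans
        (pow_le_pow_right₀ hD1 hs))
  calc ‖T x ^ n‖ ≤ (‖(1 : 𝔸)‖ + 1) * D ^ k / r * (r ^ (n / k) * r) := by
        rw [div_mul_eq_mul_div, le_div_iff₀ hr0]
        calc _ ≤ (‖(1 : 𝔸)‖ + 1) * r ^ (n / k) * D ^ k * r := by gcongr
          _ = _ := by ring
    _ ≤ _ := by gcongr

end PowerBounds

/-! ### Spectral radius and eigenvectors of complex matrices. -/

section Spectral

variable {ι : Type*} [Fintype ι] [DecidableEq ι]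

theorem mem_spectrum_iff_exists_mulVec {T : Matrix ι ι ℂ} {μ : ℂ} :
    μ ∈ spectrum ℂ T ↔ ∃ v : ι → ℂ, v ≠ 0 ∧ T *ᵥ v = μ • v := by
  rw [spectrum.mem_iff, Matrix.isUnit_iff_isUnit_det, isUnit_iff_ne_zero, not_not,
    ← Matrix.exists_mulVec_eq_zero_iff]
  refine exists_congr fun v => and_congr_right fun _ => ?_
  rw [Matrix.sub_mulVec, sub_eq_zero, Algebra.algebraMap_eq_smul_one, Matrix.smul_mulVec,
    Matrix.one_mulVec, eq_comm]

attribute [local instance] Matrix.linftyOpNormedRing Matrix.linftyOpNormedAlgebra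

theorem spectralRadius_lt_one_of_forall [Nonempty ι] {T : Matrix ι ι ℂ}
    (h : ∀ (μ : ℂ) (v : ι → ℂ), v ≠ 0 → T *ᵥ v = μ • v → ‖μ‖ < 1) :
    spectralRadius ℂ T < 1 := by
  have := spectrum.spectralRadius_lt_of_forall_lt (r := 1) T (fun z hz => by
    obtain ⟨v, hv, hTv⟩ := mem_spectrum_iff_exists_mulVec.mp hz
    exact_mod_cast h z v hv hTv)
  simpa using this

theorem norm_bilin_le (T : Matrix ι ι ℂ) (ξ η : ι → ℂ) :
    ‖ξ ⬝ᵥ (T *ᵥ η)‖ ≤ ((∑ i, ‖ξ i‖) * ‖η‖) * ‖T‖ := by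
  calc ‖ξ ⬝ᵥ (T *ᵥ η)‖ ≤ ∑ i, ‖ξ i * (T *ᵥ η) i‖ := norm_sum_le _ _
    _ ≤ ∑ i, ‖ξ i‖ * (‖T‖ * ‖η‖) := by
      refine Finset.sum_le_sum fun i _ => ?_
      rw [norm_mul]
      exact mul_le_mul_of_nonneg_left ((norm_le_pi_norm _ i).trans
        (Matrix.linfty_opNorm_mulVec T η)) (norm_nonneg _)
    _ = _ := by rw [← Finset.sum_mul]; ring

/-- Uniform exponential decay of the bilinear forms of the powers of a family of matrices near a
point where the spectral radius is less than `1`. -/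
theorem exists_bilin_pow_bound {X : Type*} [TopologicalSpace X] {T : X → Matrix ι ι ℂ} {x₀ : X}
    (hT : ContinuousAt T x₀) (h : spectralRadius ℂ (T x₀) < 1) (ξ η : ι → ℂ) :
    ∃ C ρ : ℝ, 0 < ρ ∧ ρ < 1 ∧ 0 ≤ C ∧
      ∀ᶠ x in 𝓝 x₀, ∀ n : ℕ, ‖ξ ⬝ᵥ (T x ^ n *ᵥ η)‖ ≤ C * ρ ^ n := by
  obtain ⟨C, ρ, h0, h1, hC, hev⟩ := exists_pow_bound_of_spectralRadius_lt_one hT h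
  refine ⟨((∑ i, ‖ξ i‖) * ‖η‖) * C, ρ, h0, h1, by positivity, ?_⟩
  filter_upwards [hev] with x hx n
  calc _ ≤ _ := norm_bilin_le _ _ _
    _ ≤ ((∑ i, ‖ξ i‖) * ‖η‖) * (C * ρ ^ n) := by gcongr; exact hx n
    _ = _ := by ring

/-- Uniform exponential decay on a compact set of parameters. -/
theorem exists_bilin_pow_bound_of_isCompact {X : Type*} [TopologicalSpace X]
    {T : X → Matrix ι ι ℂ} {S : Set X} (hS : IsCompact S) (hT : Continuous T)
    (h : ∀ x ∈ S, spectralRadius ℂ (T x) < 1) (ξ η : ι → ℂ) :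
    ∃ C ρ : ℝ, 0 < ρ ∧ ρ < 1 ∧ 0 ≤ C ∧
      ∀ x ∈ S, ∀ n : ℕ, ‖ξ ⬝ᵥ (T x ^ n *ᵥ η)‖ ≤ C * ρ ^ n := by
  refine hS.induction_on (p := fun S => ∃ C ρ : ℝ, 0 < ρ ∧ ρ < 1 ∧ 0 ≤ C ∧
      ∀ x ∈ S, ∀ n : ℕ, ‖ξ ⬝ᵥ (T x ^ n *ᵥ η)‖ ≤ C * ρ ^ n) ?_ ?_ ?_ ?_
  · exact ⟨0, 1 / 2, by norm_num, by norm_num, le_rfl, by simp⟩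
  · rintro s t hst ⟨C, ρ, h0, h1, hC, ht⟩
    exact ⟨C, ρ, h0, h1, hC, fun x hx => ht x (hst hx)⟩
  · rintro s t ⟨C, ρ, h0, h1, hC, hs⟩ ⟨C', ρ', h0', h1', hC', ht⟩
    refine ⟨max C C', max ρ ρ', lt_max_of_lt_left h0, max_lt h1 h1', le_max_of_le_left hC, ?_⟩
    rintro x (hx | hx) n
    · exact (hs x hx n).trans (by gcongr <;> exact le_max_left _ _)
    · exact (ht x hx n).trans (by gcongr <;> exact le_max_right _ _)
  · intro x hx
    obtain ⟨C, ρ, h0, h1, hC, hev⟩ := exists_bilin_pow_bound hT.continuousAt (h x hx) ξ η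
    exact ⟨_, mem_nhdsWithin_of_mem_nhds hev, C, ρ, h0, h1, hC, fun y hy => hy⟩

end Spectral

/-! ### Perron's theorem for primitive matrices. -/

section Perron

variable {ι : Type*}

theorem norm_map_ofReal_le {M : Matrix ι ι ℝ} (hM : ∀ i j, 0 ≤ M i j) (i j : ι) :
    ‖M.map (algebraMap ℝ ℂ) i j‖ ≤ M i j := by
  simp [abs_of_nonneg (hM i j)]

variable [Fintype ι]

theorem mulVec_pos_of_pos {M : Matrix ι ι ℝ} (hM : ∀ i j, 0 < M i j) {x : ι → ℝ}
    (hx : ∀ i, 0 ≤ x i) (hx0 : x ≠ 0) (i : ι) : 0 < (M *ᵥ x) i := by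
  obtain ⟨j, hj⟩ := Function.ne_iff.mp hx0
  exact Finset.sum_pos' (fun j _ => mul_nonneg (hM i j).le (hx j))
    ⟨j, Finset.mem_univ _, mul_pos (hM i j) (lt_of_le_of_ne (hx j) (Ne.symm hj))⟩

theorem mulVec_mono_of_nonneg {M : Matrix ι ι ℝ} (hM : ∀ i j, 0 ≤ M i j) {x y : ι → ℝ}
    (h : ∀ i, x i ≤ y i) (i : ι) : (M *ᵥ x) i ≤ (M *ᵥ y) i :=
  Finset.sum_le_sum fun j _ => mul_le_mul_of_nonneg_left (h j) (hM i j)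

theorem norm_mulVec_le {Q : Matrix ι ι ℂ} {P : Matrix ι ι ℝ} (hQ : ∀ i j, ‖Q i j‖ ≤ P i j)
    (v : ι → ℂ) (i : ι) : ‖(Q *ᵥ v) i‖ ≤ (P *ᵥ fun j => ‖v j‖) i := by
  refine (norm_sum_le _ _).trans (Finset.sum_le_sum fun j _ => ?_)
  rw [norm_mul]
  exact mul_le_mul_of_nonneg_right (hQ i j) (norm_nonneg _)

variable [DecidableEq ι]

theorem map_pow_mulVec_ofReal (M : Matrix ι ι ℝ) (n : ℕ) (x : ι → ℝ) :
    M.map (algebraMap ℝ ℂ) ^ n *ᵥ (fun i => (x i : ℂ)) = fun i => (((M ^ n) *ᵥ x) i : ℂ) := by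
  funext i
  rw [← Matrix.map_pow]
  exact ((algebraMap ℝ ℂ).map_mulVec (M ^ n) x i).symm

theorem map_mulVec_ofReal (M : Matrix ι ι ℝ) (x : ι → ℝ) :
    M.map (algebraMap ℝ ℂ) *ᵥ (fun i => (x i : ℂ)) = fun i => ((M *ᵥ x) i : ℂ) := by
  simpa using map_pow_mulVec_ofReal M 1 x

section

attribute [local instance] Matrix.linftyOpNormedRing Matrix.linftyOpNormedAlgebra

theorem exists_norm_eq_spectralRadius_toReal [Nonempty ι] (T : Matrix ι ι ℂ) :
    (∃ (μ : ℂ) (v : ι → ℂ), v ≠ 0 ∧ T *ᵥ v = μ • v ∧ ‖μ‖ = (spectralRadius ℂ T).toReal) ∧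
    ∀ (μ : ℂ) (v : ι → ℂ), v ≠ 0 → T *ᵥ v = μ • v → ‖μ‖ ≤ (spectralRadius ℂ T).toReal := by
  obtain ⟨μ, hμ, he⟩ := spectrum.exists_nnnorm_eq_spectralRadius T
  obtain ⟨v, hv, hTv⟩ := mem_spectrum_iff_exists_mulVec.mp hμ
  refine ⟨⟨μ, v, hv, hTv, by rw [← he]; simp⟩, fun ν w hw hTw => ?_⟩
  have h1 : (‖ν‖₊ : ENNReal) ≤ spectralRadius ℂ T :=
    le_iSup₂ (f := fun (k : ℂ) (_ : k ∈ spectrum ℂ T) => (‖k‖₊ : ENNReal)) ν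
      (mem_spectrum_iff_exists_mulVec.mpr ⟨w, hw, hTw⟩)
  rw [← he] at h1 ⊢
  exact_mod_cast h1

end

/-- A real multiple of a matrix that exceeds the spectral radius dominates its powers. -/
theorem spectralRadius_inv_smul_lt_one [Nonempty ι] {T : Matrix ι ι ℂ} {r : ℝ}
    (h : (spectralRadius ℂ T).toReal < r) : spectralRadius ℂ ((r : ℂ)⁻¹ • T) < 1 := by
  have hr : 0 < r := ENNReal.toReal_nonneg.trans_lt h
  have hr' : (r : ℂ) ≠ 0 := by exact_mod_cast hr.ne'
  refine spectralRadius_lt_one_of_forall fun μ v hv hTv => ?_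
  have h1 : T *ᵥ v = ((r : ℂ) * μ) • v := by
    rw [Matrix.smul_mulVec, inv_smul_eq_iff₀ hr'] at hTv
    rw [hTv, smul_smul]
  have h2 := (exists_norm_eq_spectralRadius_toReal T).2 _ v hv h1
  rw [norm_mul, Complex.norm_real, Real.norm_of_nonneg hr.le] at h2
  by_contra hcon
  rw [not_lt] at hcon
  nlinarith

/-- **Perron's theorem**: a positive eigenvector of a primitive matrix for its spectral radius. -/
theorem exists_pos_eigenvector [Nonempty ι] {M : Matrix ι ι ℝ} (hM : M.IsPrimitive) :
    0 < (spectralRadius ℂ (M.map (algebraMap ℝ ℂ))).toReal ∧ ∃ v : ι → ℝ, (∀ i, 0 < v i) ∧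
      M *ᵥ v = (spectralRadius ℂ (M.map (algebraMap ℝ ℂ))).toReal • v := by
  set T := M.map (algebraMap ℝ ℂ) with hT
  set r := (spectralRadius ℂ T).toReal with hr
  have hr0 : 0 ≤ r := ENNReal.toReal_nonneg
  obtain ⟨⟨μ, v, hv, hTv, hμ⟩, -⟩ := exists_norm_eq_spectralRadius_toReal T
  obtain ⟨hnn, k, hk, hpos⟩ := hM
  set x : ι → ℝ := fun i => ‖v i‖ with hx
  have hx0 : ∀ i, 0 ≤ x i := fun i => norm_nonneg _
  have hxne : x ≠ 0 := by
    intro h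
    apply hv
    funext i
    exact norm_eq_zero.mp (congrFun h i)
  have hle : ∀ i, r * x i ≤ (M *ᵥ x) i := by
    intro i
    have h1 := norm_mulVec_le (norm_map_ofReal_le hnn) v i
    rwa [← hT, hTv, Pi.smul_apply, norm_smul, hμ] at h1
  have hMkx := mulVec_pos_of_pos hpos hx0 hxne
  -- If the nonnegative defect `d = M x - r x` were nonzero, `M ^ k` would make it strictly
  -- positive. Then `y = M ^ k x` satisfies `M y ≥ (r + ε) y` for some `ε > 0`, so the powers of `M`
  -- grow faster than the spectral radius permits.
  have heq : M *ᵥ x = r • x := by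
    by_contra hne
    set d : ι → ℝ := M *ᵥ x - r • x with hd
    have hd0 : ∀ i, 0 ≤ d i := fun i => by simpa [hd] using hle i
    have hMkd := mulVec_pos_of_pos hpos hd0 (sub_ne_zero.mpr hne)
    set y : ι → ℝ := M ^ k *ᵥ x with hy
    have hMy : M *ᵥ y = r • y + M ^ k *ᵥ d := by
      rw [hd, Matrix.mulVec_sub, Matrix.mulVec_smul, ← hy, Matrix.mulVec_mulVec, hy,
        Matrix.mulVec_mulVec, ← pow_succ, ← pow_succ']
      abel
    obtain ⟨i₀, -, hi₀⟩ := Finset.exists_min_image Finset.univ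
      (fun i => (M ^ k *ᵥ d) i / y i) Finset.univ_nonempty
    set ε : ℝ := (M ^ k *ᵥ d) i₀ / y i₀ with hε
    have hε0 : 0 < ε := div_pos (hMkd i₀) (hMkx i₀)
    have hstep : ∀ i, (r + ε) * y i ≤ (M *ᵥ y) i := by
      intro i
      have := hi₀ i (Finset.mem_univ _)
      rw [le_div_iff₀ (hMkx i)] at this
      rw [hMy, Pi.add_apply, Pi.smul_apply, smul_eq_mul, add_mul]
      linarith
    have hpow : ∀ (n : ℕ) (i : ι), (r + ε) ^ n * y i ≤ (M ^ n *ᵥ y) i := by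
      intro n
      induction n with
      | zero => simp
      | succ n ih =>
        intro i
        calc (r + ε) ^ (n + 1) * y i = (r + ε) ^ n * ((r + ε) * y i) := by ring
          _ ≤ (r + ε) ^ n * (M *ᵥ y) i := by gcongr; exact hstep i
          _ = (M *ᵥ ((r + ε) ^ n • y)) i := by rw [Matrix.mulVec_smul]; simp
          _ ≤ (M *ᵥ (M ^ n *ᵥ y)) i := mulVec_mono_of_nonneg hnn (fun j => by simpa using ih j) i
          _ = _ := by rw [Matrix.mulVec_mulVec, ← pow_succ']
    have hrε : 0 < r + ε := by linarith
    have hspec : spectralRadius ℂ (((r + ε : ℝ) : ℂ)⁻¹ • T) < 1 :=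
      spectralRadius_inv_smul_lt_one (by rw [← hr]; linarith)
    -- The family is constant, so its real parameter is a dummy. The coordinate `i₀` of `(r +
    -- ε)^{-n} M^n y` must tend to 0 although it stays above `y i₀ > 0`.
    obtain ⟨C, ρ, hρ0, hρ1, hC, hev⟩ := exists_bilin_pow_bound
      (T := fun _ : ℝ => ((r + ε : ℝ) : ℂ)⁻¹ • T) (x₀ := 0) continuousAt_const hspec
      (Pi.single i₀ 1) (fun i => (y i : ℂ))
    have hbd : ∀ n : ℕ, y i₀ ≤ C * ρ ^ n := by
      intro n
      have h1 := hev.self_of_nhds n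
      rw [smul_pow, Matrix.smul_mulVec, hT, map_pow_mulVec_ofReal, single_one_dotProduct,
        Pi.smul_apply, smul_eq_mul, norm_mul, norm_pow, norm_inv, Complex.norm_real,
        Complex.norm_real, Real.norm_of_nonneg hrε.le] at h1
      refine le_trans ?_ h1
      rw [inv_pow, ← div_eq_inv_mul, le_div_iff₀ (pow_pos hrε n), mul_comm]
      exact (hpow n i₀).trans (le_abs_self _)
    have hlim : Tendsto (fun n : ℕ => C * ρ ^ n) atTop (𝓝 (C * 0)) :=
      (tendsto_pow_atTop_nhds_zero_of_lt_one hρ0.le hρ1).const_mul C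
    have := ge_of_tendsto' hlim hbd
    rw [mul_zero] at this
    exact absurd (hMkx i₀) (not_lt.mpr this)
  have hMk : ∀ n : ℕ, M ^ n *ᵥ x = r ^ n • x := by
    intro n
    induction n with
    | zero => simp
    | succ n ih =>
      rw [pow_succ', ← Matrix.mulVec_mulVec, ih, Matrix.mulVec_smul, heq, smul_smul, pow_succ]
  have hxpos : ∀ i, 0 < r ^ k * x i := fun i => by
    have := hMkx i
    rwa [hMk k] at this
  have hrk : 0 < r := by
    refine lt_of_le_of_ne hr0 fun h => ?_
    have := hxpos (Classical.arbitrary ι)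
    rw [← h, zero_pow hk.ne', zero_mul] at this
    exact lt_irrefl _ this
  exact ⟨hrk, x, fun i => (mul_pos_iff_of_pos_left (pow_pos hrk k)).mp (hxpos i), heq⟩

theorem IsPrimitive.transpose {M : Matrix ι ι ℝ} (hM : M.IsPrimitive) : Mᵀ.IsPrimitive := by
  obtain ⟨hnn, k, hk, hpos⟩ := hM
  refine ⟨fun i j => hnn j i, k, hk, fun i j => ?_⟩
  rw [← Matrix.transpose_pow]
  exact hpos j i

/-- A positive left eigenvector. -/
theorem exists_pos_left_eigenvector [Nonempty ι] {M : Matrix ι ι ℝ} (hM : M.IsPrimitive)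
    {r : ℝ} {v : ι → ℝ} (hv : ∀ i, 0 < v i) (hMv : M *ᵥ v = r • v) :
    ∃ w : ι → ℝ, (∀ i, 0 < w i) ∧ w ᵥ* M = r • w := by
  obtain ⟨-, w, hw, hMw⟩ := exists_pos_eigenvector (IsPrimitive.transpose hM)
  rw [Matrix.mulVec_transpose] at hMw
  set s := (spectralRadius ℂ (Mᵀ.map (algebraMap ℝ ℂ))).toReal
  -- Evaluating `w' M v` in two ways identifies the Perron values of `M` and its transpose, since `w
  -- ⬝ᵥ v > 0`.
  have h1 : s * (w ⬝ᵥ v) = r * (w ⬝ᵥ v) := by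
    rw [← smul_eq_mul, ← smul_dotProduct, ← hMw, ← Matrix.dotProduct_mulVec, hMv,
      dotProduct_smul, smul_eq_mul]
  have h2 : 0 < w ⬝ᵥ v := Finset.sum_pos (fun i _ => mul_pos (hw i) (hv i)) Finset.univ_nonempty
  exact ⟨w, hw, by rw [hMw, mul_right_cancel₀ h2.ne' h1]⟩

end Perron

/-! ### Maximum principle and equality in the triangle inequality. -/

section MaximumPrinciple

/-- Strict convexity of the disc. After rotation by the conjugate of `t`, the real parts are at most
1 and average to 1, so each one with positive weight equals 1, and the bound on the modulus kills
the imaginary part. -/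
theorem eq_of_sum_mul_eq_of_norm_le_one {κ : Type*} {s : Finset κ} {w : κ → ℝ} {c : κ → ℂ} {t : ℂ}
    (hw : ∀ j ∈ s, 0 ≤ w j) (hsum : ∑ j ∈ s, w j = 1) (hc : ∀ j ∈ s, ‖c j‖ ≤ 1) (ht : ‖t‖ = 1)
    (h : ∑ j ∈ s, (w j : ℂ) * c j = t) {j : κ} (hj : j ∈ s) (hwj : 0 < w j) : c j = t := by
  have htt : (starRingEnd ℂ) t * t = 1 := by
    rw [mul_comm, Complex.mul_conj, Complex.normSq_eq_norm_sq, ht]; norm_num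
  have hn : ∀ j ∈ s, ‖(starRingEnd ℂ) t * c j‖ ≤ 1 := fun j hj => by
    rw [norm_mul, RCLike.norm_conj, ht, one_mul]; exact hc j hj
  have hre : ∀ j ∈ s, ((starRingEnd ℂ) t * c j).re ≤ 1 := fun j hj =>
    (Complex.re_le_norm _).trans (hn j hj)
  have h0 : ∑ j ∈ s, w j * (1 - ((starRingEnd ℂ) t * c j).re) = 0 := by
    have h1 : ∑ j ∈ s, w j * ((starRingEnd ℂ) t * c j).re = 1 := by
      have := congrArg (fun z => ((starRingEnd ℂ) t * z).re) h
      simp only [htt, Finset.mul_sum, Complex.re_sum, Complex.one_re] at this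
      rw [← this]
      refine Finset.sum_congr rfl fun j _ => ?_
      rw [← Complex.re_ofReal_mul]
      ring_nf
    simp only [mul_sub, mul_one, Finset.sum_sub_distrib, hsum, h1, sub_self]
  have h2 := (Finset.sum_eq_zero_iff_of_nonneg (fun j hj =>
    mul_nonneg (hw j hj) (sub_nonneg.mpr (hre j hj)))).mp h0 j hj
  have h3 : ((starRingEnd ℂ) t * c j).re = 1 := by
    rcases mul_eq_zero.mp h2 with h | h
    · exact absurd h hwj.ne'
    · linarith
  have h4 : (starRingEnd ℂ) t * c j = 1 := by
    have hsq := Complex.sq_norm ((starRingEnd ℂ) t * c j)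
    rw [Complex.normSq_apply, h3] at hsq
    have := hn j hj
    have him : ((starRingEnd ℂ) t * c j).im = 0 := by
      have : ((starRingEnd ℂ) t * c j).im * ((starRingEnd ℂ) t * c j).im ≤ 0 := by
        nlinarith [norm_nonneg ((starRingEnd ℂ) t * c j)]
      nlinarith
    exact Complex.ext h3 him
  calc c j = ((starRingEnd ℂ) t * t) * c j := by rw [htt, one_mul]
    _ = t * ((starRingEnd ℂ) t * c j) := by ring
    _ = t := by rw [h4, mul_one]

variable {ι : Type*} [Fintype ι]

theorem sum_row_eq_one {P : Matrix ι ι ℝ} (hP : P *ᵥ 1 = 1) (i : ι) : ∑ j, P i j = 1 := by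
  simpa [Matrix.mulVec, dotProduct] using congrFun hP i

variable [DecidableEq ι]

theorem pow_mulVec_one {P : Matrix ι ι ℝ} (hP : P *ᵥ 1 = 1) (n : ℕ) : P ^ n *ᵥ 1 = 1 := by
  induction n with
  | zero => simp
  | succ n ih => rw [pow_succ, ← Matrix.mulVec_mulVec, hP, ih]

/-- The eigenvectors, for eigenvalues of modulus at least `1`, of a matrix dominated by a primitive
stochastic matrix have constant modulus. -/
theorem norm_eq_of_eigenvector {P : Matrix ι ι ℝ} (hP : P.IsPrimitive) (hP1 : P *ᵥ 1 = 1)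
    {Q : Matrix ι ι ℂ} (hQ : ∀ i j, ‖Q i j‖ ≤ P i j) {μ : ℂ} (hμ : 1 ≤ ‖μ‖) {v : ι → ℂ}
    (hv : v ≠ 0) (hQv : Q *ᵥ v = μ • v) : ‖μ‖ = 1 ∧ ∃ c : ℝ, 0 < c ∧ ∀ i, ‖v i‖ = c := by
  obtain ⟨hnn, k, hk, hpos⟩ := hP
  obtain ⟨j₀, hj₀⟩ := Function.ne_iff.mp hv
  have hne : Nonempty ι := ⟨j₀⟩
  set x : ι → ℝ := fun i => ‖v i‖ with hx
  have hle' : ∀ i, ‖μ‖ * x i ≤ (P *ᵥ x) i := fun i => by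
    have h1 := norm_mulVec_le hQ v i
    rwa [hQv, Pi.smul_apply, norm_smul] at h1
  have hle : ∀ i, x i ≤ (P *ᵥ x) i := fun i =>
    (le_mul_of_one_le_left (norm_nonneg _) hμ).trans (hle' i)
  have hpow : ∀ (n : ℕ) (i : ι), x i ≤ (P ^ n *ᵥ x) i := by
    intro n
    induction n with
    | zero => simp
    | succ n ih =>
      intro i
      rw [pow_succ', ← Matrix.mulVec_mulVec]
      exact (hle i).trans (mulVec_mono_of_nonneg hnn ih i)
  obtain ⟨i₀, -, hi₀⟩ := Finset.exists_max_image Finset.univ x Finset.univ_nonempty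
  -- At a maximum of `x`, the average of `x` along row `i₀` of `P ^ k` is at least that maximum. All
  -- the weights are positive, so `x` is constant.
  have hconst : ∀ j, x j = x i₀ := by
    have h1 : ∑ j, (P ^ k) i₀ j * (x i₀ - x j) = 0 := by
      refine le_antisymm ?_ (Finset.sum_nonneg fun j _ =>
        mul_nonneg (hpos i₀ j).le (sub_nonneg.mpr (hi₀ j (Finset.mem_univ _))))
      simp only [mul_sub, Finset.sum_sub_distrib, ← Finset.sum_mul,
        sum_row_eq_one (pow_mulVec_one hP1 k), one_mul]
      have := hpow k i₀
      simp only [Matrix.mulVec, dotProduct] at this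
      linarith
    intro j
    have h2 := (Finset.sum_eq_zero_iff_of_nonneg (fun j _ =>
      mul_nonneg (hpos i₀ j).le (sub_nonneg.mpr (hi₀ j (Finset.mem_univ _))))).mp h1 j
        (Finset.mem_univ _)
    rcases mul_eq_zero.mp h2 with h | h
    · exact absurd h (hpos i₀ j).ne'
    · linarith
  have hc : 0 < x i₀ := by
    rw [← hconst j₀]
    exact norm_pos_iff.mpr hj₀
  refine ⟨le_antisymm ?_ hμ, x i₀, hc, hconst⟩
  have h1 := hle' i₀
  have h2 : (P *ᵥ x) i₀ = x i₀ := by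
    simp only [Matrix.mulVec, dotProduct, hconst, ← Finset.sum_mul, sum_row_eq_one hP1, one_mul]
  rw [h2] at h1
  by_contra hcon
  rw [not_le] at hcon
  nlinarith

/-- The eigenvectors of a primitive stochastic matrix, for eigenvalues of modulus at least `1`,
are constant. -/
theorem eq_of_stochastic_eigenvector {P : Matrix ι ι ℝ} (hP : P.IsPrimitive) (hP1 : P *ᵥ 1 = 1)
    {μ : ℂ} (hμ : 1 ≤ ‖μ‖) {v : ι → ℂ} (hPv : P.map (algebraMap ℝ ℂ) *ᵥ v = μ • v) (i j : ι) :
    v i = v j := by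
  by_cases hv : v = 0
  · simp [hv]
  obtain ⟨hμ1, c, hc, hvc⟩ :=
    norm_eq_of_eigenvector hP hP1 (norm_map_ofReal_le hP.nonneg) hμ hv hPv
  obtain ⟨hnn, k, hk, hpos⟩ := hP
  have hpow : ∀ n : ℕ, P.map (algebraMap ℝ ℂ) ^ n *ᵥ v = μ ^ n • v := by
    intro n
    induction n with
    | zero => simp
    | succ n ih =>
      rw [pow_succ', ← Matrix.mulVec_mulVec, ih, Matrix.mulVec_smul, hPv, smul_smul, pow_succ]
  have hcc : (c : ℂ) ≠ 0 := by exact_mod_cast hc.ne'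
  -- Row `i` of `P ^ k` averages unimodular numbers to a unimodular number with positive weights, so
  -- all of them agree with a value that does not depend on `j`.
  have key : ∀ j, v j / c = μ ^ k * v i / c := by
    intro j
    refine eq_of_sum_mul_eq_of_norm_le_one (s := Finset.univ) (w := fun j => (P ^ k) i j)
      (c := fun j => v j / c) (fun j _ => (hpos i j).le)
      (sum_row_eq_one (pow_mulVec_one hP1 k) i) (fun j _ => ?_) ?_ ?_ (Finset.mem_univ j)
      (hpos i j)
    · rw [norm_div, hvc, Complex.norm_real, Real.norm_of_nonneg hc.le, div_self hc.ne']
    · rw [norm_div, norm_mul, norm_pow, hμ1, hvc, Complex.norm_real, Real.norm_of_nonneg hc.le,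
        one_pow, one_mul, div_self hc.ne']
    · have := congrFun (hpow k) i
      rw [← Matrix.map_pow] at this
      simp only [Matrix.mulVec, dotProduct, Matrix.map_apply, Pi.smul_apply, smul_eq_mul,
        Complex.coe_algebraMap] at this
      rw [← this, Finset.sum_div]
      exact Finset.sum_congr rfl fun j _ => by ring
  have := (key i).trans (key j).symm
  field_simp at this
  exact this

end MaximumPrinciple

namespace LinRep

/-! ### Potentials on the labelled graph and aperiodicity. -/

section Labels

variable {ι : Type} (R : LinRep ι)

variable {R} in
/-- An additive potential along the edges of the transition graph, summed along a path. -/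
theorem IsLabelledPath.potential_sub {g : ι → ℝ} {β : ℝ}
    (hA : ∀ i j, 0 < R.A i j → 1 + g j - g i = β) (hB : ∀ i j, 0 < R.B i j → g j - g i = β)
    {i k : ι} {w : List Letter} (h : R.IsLabelledPath i w k) :
    (w.count Letter.a : ℝ) + g k - g i = β * w.length := by
  induction h with
  | nil i => simp
  | cons x h p ih =>
    cases x with
    | a =>
      have := hA _ _ h
      rw [List.count_cons_self, List.length_cons]
      push_cast
      linarith
    | b =>
      have := hB _ _ h
      rw [List.count_cons_of_ne (by decide), List.length_cons]
      push_cast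
      linarith

variable {R} in
/-- The number of `a` minus its mean value is not a coboundary for an aperiodic pair. -/
theorem IsAperiodicPair.not_potential (haper : R.IsAperiodicPair) (g : ι → ℝ) (β : ℝ)
    (hA : ∀ i j, 0 < R.A i j → 1 + g j - g i = β) (hB : ∀ i j, 0 < R.B i j → g j - g i = β) :
    False := by
  -- A potential makes every cycle difference 0, so any integer divides them all; 2 is chosen as one
  -- different from 1.
  have h2 : (2 : ℕ) = 1 := by
    refine haper 2 ?_
    rintro _ ⟨w₁, w₂, ⟨-, i₁, h₁⟩, ⟨-, i₂, h₂⟩, hlen, rfl⟩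
    have e₁ := h₁.potential_sub hA hB
    have e₂ := h₂.potential_sub hA hB
    rw [hlen] at e₁
    have : (w₁.count Letter.a : ℝ) = w₂.count Letter.a := by linarith
    have : w₁.count Letter.a = w₂.count Letter.a := by exact_mod_cast this
    simp [this]
  omega

variable {R} in
/-- A multiplicative potential along the edges of the transition graph, multiplied along a path. -/
theorem IsLabelledPath.potential_mul {v : ι → ℂ} {ω μ : ℂ}
    (hA : ∀ i j, 0 < R.A i j → ω * v j = μ * v i) (hB : ∀ i j, 0 < R.B i j → v j = μ * v i)
    {i k : ι} {w : List Letter} (h : R.IsLabelledPath i w k) :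
    ω ^ w.count Letter.a * v k = μ ^ w.length * v i := by
  induction h with
  | nil i => simp
  | cons x h p ih =>
    cases x with
    | a =>
      have := hA _ _ h
      rw [List.count_cons_self, List.length_cons, pow_succ', mul_assoc, ih, mul_left_comm, this]
      ring
    | b =>
      have := hB _ _ h
      rw [List.count_cons_of_ne (by decide), List.length_cons, ih, this]
      ring

variable {R} in
/-- A twist by `ω` of an aperiodic pair is a coboundary only if `ω = 1`. -/
theorem IsAperiodicPair.eq_one_of_potential (haper : R.IsAperiodicPair) {v : ι → ℂ} {ω μ : ℂ}
    (hv : ∀ i, v i ≠ 0) (hω : ω ≠ 0)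
    (hA : ∀ i j, 0 < R.A i j → ω * v j = μ * v i) (hB : ∀ i j, 0 < R.B i j → v j = μ * v i) :
    ω = 1 := by
  -- If `ω` has infinite order then `orderOf ω = 0`, and divisibility by 0 says that all differences
  -- vanish; the same argument covers both cases.
  have h1 := haper (orderOf ω) (by
    rintro _ ⟨w₁, w₂, ⟨-, i₁, h₁⟩, ⟨-, i₂, h₂⟩, hlen, rfl⟩
    have e₁ := mul_right_cancel₀ (hv _) (h₁.potential_mul hA hB)
    have e₂ := mul_right_cancel₀ (hv _) (h₂.potential_mul hA hB)
    have e₃ : ω ^ w₁.count Letter.a = ω ^ w₂.count Letter.a := by rw [e₁, e₂, hlen]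
    set u : ℂˣ := Units.mk0 ω hω with hu
    have e₄ : u ^ ((w₁.count Letter.a : ℤ) - (w₂.count Letter.a : ℤ)) = 1 := by
      rw [_root_.zpow_sub, zpow_natCast, zpow_natCast, mul_inv_eq_one]
      exact Units.ext (by simpa [hu] using e₃)
    have e₅ : orderOf u = orderOf ω := by rw [← orderOf_units]; simp [hu]
    rw [← e₅]
    exact orderOf_dvd_iff_zpow_eq_one.mpr e₄)
  exact orderOf_eq_one_iff.mp h1

end Labels

/-! ### The twisted matrix, and stochastic aperiodic pairs. -/

variable {ι : Type} (R : LinRep ι)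

theorem M_apply (i j : ι) : R.M i j = R.A i j + R.B i j := rfl

/-- The complex matrix `A e^z + B`. -/
noncomputable def twist (z : ℂ) : Matrix ι ι ℂ :=
  Complex.exp z • R.A.map (algebraMap ℝ ℂ) + R.B.map (algebraMap ℝ ℂ)

theorem twist_apply (z : ℂ) (i j : ι) :
    R.twist z i j = Complex.exp z * R.A i j + R.B i j := rfl

theorem twist_zero : R.twist 0 = R.M.map (algebraMap ℝ ℂ) := by
  ext i j
  simp [twist_apply, M_apply]

theorem norm_twist_apply_le (θ : ℝ) (i j : ι) : ‖R.twist (θ * Complex.I) i j‖ ≤ R.M i j := by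
  rw [twist_apply, M_apply]
  refine (norm_add_le _ _).trans (le_of_eq ?_)
  rw [norm_mul, Complex.norm_exp_ofReal_mul_I, one_mul, Complex.norm_real, Complex.norm_real,
    Real.norm_of_nonneg (R.A_nonneg i j), Real.norm_of_nonneg (R.B_nonneg i j)]

variable [Fintype ι] [DecidableEq ι]

/-- The pair `(A, B)` is aperiodic, `A + B` is stochastic and primitive, and its stationary
distribution is `p`. -/
structure IsStochastic (p : ι → ℝ) : Prop where
  mulVec_one : R.M *ᵥ 1 = 1
  vecMul : p ᵥ* R.M = p
  pos : ∀ i, 0 < p i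
  sum_eq_one : ∑ i, p i = 1
  primitive : R.M.IsPrimitive
  aperiodic : R.IsAperiodicPair

variable {R} {p : ι → ℝ}

namespace IsStochastic

theorem nonempty (hR : R.IsStochastic p) : Nonempty ι := by
  by_contra h
  rw [not_nonempty_iff] at h
  simpa using hR.sum_eq_one

/-- An eigenvector for `|μ| ≥ 1` has constant modulus by the maximum principle. Equality in the
triangle inequality then gives `e^{iθ} v_j = μ v_i` on `a`-edges and `v_j = μ v_i` on `b`-edges, and
aperiodicity forces `e^{iθ} = 1`. -/
theorem spectralRadius_twist_lt_one (hR : R.IsStochastic p) {θ : ℝ}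
    (hθ : Complex.exp (θ * Complex.I) ≠ 1) : spectralRadius ℂ (R.twist (θ * Complex.I)) < 1 := by
  have := hR.nonempty
  refine spectralRadius_lt_one_of_forall fun μ v hv hQv => ?_
  by_contra hμ
  rw [not_lt] at hμ
  obtain ⟨hμ1, c, hc, hvc⟩ := norm_eq_of_eigenvector hR.primitive hR.mulVec_one
    (R.norm_twist_apply_le θ) hμ hv hQv
  have hcc : (c : ℂ) ≠ 0 := by exact_mod_cast hc.ne'
  set ω := Complex.exp (θ * Complex.I) with hω
  have hω1 : ‖ω‖ = 1 := Complex.norm_exp_ofReal_mul_I θ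
  have hvc' : ∀ i, ‖v i / c‖ = 1 := fun i => by
    rw [norm_div, hvc, Complex.norm_real, Real.norm_of_nonneg hc.le, div_self hc.ne']
  -- The index set `ι ⊕ ι` separates the `a`-edges from the `b`-edges leaving `i`: two states may be
  -- joined by both letters, with different phases.
  have key : ∀ i, ∀ s ∈ (Finset.univ : Finset (ι ⊕ ι)),
      0 < Sum.elim (R.A i) (R.B i) s →
      Sum.elim (fun j => ω * (v j / c)) (fun j => v j / c) s = μ * (v i / c) := by
    intro i s hs hpos
    refine eq_of_sum_mul_eq_of_norm_le_one (w := Sum.elim (R.A i) (R.B i)) ?_ ?_ ?_ ?_ ?_ hs hpos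
    · rintro (j | j) - <;> simp [R.A_nonneg, R.B_nonneg]
    · rw [Fintype.sum_sum_type, ← sum_row_eq_one hR.mulVec_one i]
      simp [M_apply, Finset.sum_add_distrib]
    · rintro (j | j) - <;> simp only [Sum.elim_inl, Sum.elim_inr, norm_mul, hω1, hvc', one_mul,
        le_refl]
    · rw [norm_mul, hμ1, hvc', one_mul]
    · have := congrFun hQv i
      simp only [Matrix.mulVec, dotProduct, twist_apply, Pi.smul_apply, smul_eq_mul] at this
      rw [Fintype.sum_sum_type, ← mul_div_assoc, ← this, Finset.sum_div, ← Finset.sum_add_distrib]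
      refine Finset.sum_congr rfl fun j _ => ?_
      simp only [Sum.elim_inl, Sum.elim_inr, ← hω]
      ring
  refine hθ (hR.aperiodic.eq_one_of_potential (v := v) (μ := μ) ?_ (Complex.exp_ne_zero _) ?_ ?_)
  · intro i h
    have := hvc i
    rw [h, norm_zero] at this
    exact hc.ne this
  · intro i j h
    have := key i (Sum.inl j) (Finset.mem_univ _) h
    simp only [Sum.elim_inl] at this
    field_simp at this
    exact this
  · intro i j h
    have := key i (Sum.inr j) (Finset.mem_univ _) h
    simp only [Sum.elim_inr] at this
    field_simp at this
    exact this

end IsStochastic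

/-- The rank one matrix `1 p'`. -/
def rankOne (p : ι → ℝ) : Matrix ι ι ℂ := Matrix.vecMulVec 1 (fun i => (p i : ℂ))

omit [DecidableEq ι] in
theorem rankOne_mulVec (v : ι → ℂ) : rankOne p *ᵥ v = ((fun i => (p i : ℂ)) ⬝ᵥ v) • 1 := by
  rw [rankOne, Matrix.vecMulVec_mulVec]
  ext i
  simp

omit [DecidableEq ι] in
theorem vecMul_rankOne (v : ι → ℂ) : v ᵥ* rankOne p = (v ⬝ᵥ 1) • fun i => (p i : ℂ) := by
  rw [rankOne, Matrix.vecMul_vecMulVec]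

namespace IsStochastic

theorem cast_vecMul (hR : R.IsStochastic p) :
    (fun i => (p i : ℂ)) ᵥ* R.M.map (algebraMap ℝ ℂ) = fun i => (p i : ℂ) := by
  funext j
  have := congrArg (algebraMap ℝ ℂ) (congrFun hR.vecMul j)
  rw [(algebraMap ℝ ℂ).map_vecMul] at this
  exact this

theorem cast_mulVec_one (hR : R.IsStochastic p) :
    R.M.map (algebraMap ℝ ℂ) *ᵥ (1 : ι → ℂ) = 1 := by
  have h1 : (fun i => ((1 : ι → ℝ) i : ℂ)) = 1 := by
    funext i
    simp
  have := map_mulVec_ofReal R.M 1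
  rwa [hR.mulVec_one, h1] at this

theorem cast_dotProduct_one (hR : R.IsStochastic p) : (fun i => (p i : ℂ)) ⬝ᵥ 1 = 1 := by
  have := congrArg (algebraMap ℝ ℂ) hR.sum_eq_one
  simpa [dotProduct] using this

theorem eq_zero_of_eigenvector (hR : R.IsStochastic p) {μ : ℂ} (hμ : 1 ≤ ‖μ‖) {v : ι → ℂ}
    (hv : R.M.map (algebraMap ℝ ℂ) *ᵥ v = μ • v) (hpv : (fun i => (p i : ℂ)) ⬝ᵥ v = 0) :
    v = 0 := by
  obtain ⟨i₀⟩ := hR.nonempty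
  have hc := fun i => eq_of_stochastic_eigenvector hR.primitive hR.mulVec_one hμ hv i i₀
  have h1 : v = v i₀ • (1 : ι → ℂ) := by
    funext i
    simp [hc i]
  rw [h1, dotProduct_smul, hR.cast_dotProduct_one, smul_eq_mul, mul_one] at hpv
  rw [h1, hpv, zero_smul]

/-- Subtracting the projection `1 p'` removes the eigenvalue 1. Pairing the eigenvector equation
with `p` gives `μ (p ⬝ᵥ v) = 0`, so `v` is an eigenvector of `M` itself, constant and orthogonal to
`p`, hence zero. -/
theorem spectralRadius_sub_rankOne_lt_one (hR : R.IsStochastic p) :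
    spectralRadius ℂ (R.M.map (algebraMap ℝ ℂ) - rankOne p) < 1 := by
  have := hR.nonempty
  refine spectralRadius_lt_one_of_forall fun μ v hv hNv => ?_
  by_contra hμ
  rw [not_lt] at hμ
  have hμ0 : μ ≠ 0 := by
    rintro rfl
    norm_num at hμ
  rw [Matrix.sub_mulVec, rankOne_mulVec] at hNv
  have h1 := congrArg (fun x => (fun i => (p i : ℂ)) ⬝ᵥ x) hNv
  simp only [dotProduct_sub, dotProduct_smul, hR.cast_dotProduct_one, smul_eq_mul, mul_one] at h1
  rw [Matrix.dotProduct_mulVec, hR.cast_vecMul, sub_self] at h1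
  have h2 := (mul_eq_zero.mp h1.symm).resolve_left hμ0
  rw [h2, zero_smul, sub_zero] at hNv
  exact hv (hR.eq_zero_of_eigenvector hμ hNv h2)

/-- The mean number of `a` per letter. -/
theorem sum_mul_sum_A_mem (hR : R.IsStochastic p) :
    0 < p ⬝ᵥ (R.A *ᵥ 1) ∧ p ⬝ᵥ (R.A *ᵥ 1) < 1 := by
  have hsum : p ⬝ᵥ (R.A *ᵥ 1) + p ⬝ᵥ (R.B *ᵥ 1) = 1 := by
    rw [← dotProduct_add, ← Matrix.add_mulVec]
    change p ⬝ᵥ (R.M *ᵥ 1) = 1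
    rw [hR.mulVec_one]
    simpa [dotProduct] using hR.sum_eq_one
  have hzero : ∀ T : Matrix ι ι ℝ, (∀ i j, 0 ≤ T i j) → p ⬝ᵥ (T *ᵥ 1) ≤ 0 →
      ∀ i j, ¬ 0 < T i j := by
    intro T hT h i j hij
    refine absurd h (not_le.mpr (Finset.sum_pos' (fun i _ => mul_nonneg (hR.pos i).le
      (Finset.sum_nonneg fun j _ => by simpa using hT i j)) ⟨i, Finset.mem_univ i,
        mul_pos (hR.pos i) (Finset.sum_pos' (fun j _ => by simpa using hT i j)
          ⟨j, Finset.mem_univ j, by simpa using hij⟩)⟩))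
  -- A mean equal to 0 or 1 means that one letter labels no edge; the count of `a` then has the zero
  -- potential, against aperiodicity.
  constructor
  · by_contra h
    have hA := hzero R.A R.A_nonneg (not_lt.mp h)
    exact hR.aperiodic.not_potential 0 0 (fun i j hij => absurd hij (hA i j)) (by simp)
  · by_contra h
    have hB := hzero R.B R.B_nonneg (by linarith)
    exact hR.aperiodic.not_potential 0 1 (by simp) (fun i j hij => absurd hij (hB i j))

/-- The asymptotic variance, written with a solution `g` of the Poisson equation, is positive. -/
theorem variance_pos (hR : R.IsStochastic p) {g : ι → ℝ} {β : ℝ} (hβ : β = p ⬝ᵥ (R.A *ᵥ 1))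
    (hg : ∀ i, (R.M *ᵥ g) i = β + g i - (R.A *ᵥ 1) i) (hpg : p ⬝ᵥ g = 0) :
    0 < β - β ^ 2 + 2 * (p ⬝ᵥ (R.A *ᵥ g)) := by
  -- With `g` solving the Poisson equation, `1_a + g_j - g_i - β` is a martingale increment. Its
  -- second moment is computed here conditionally on `i` and averaged against `p` below.
  have hloc : ∀ i, ∑ j, (R.A i j * (1 + g j - g i - β) ^ 2 + R.B i j * (g j - g i - β) ^ 2) =
      (R.A *ᵥ 1) i + 2 * (R.A *ᵥ g) i + (R.M *ᵥ fun j => g j ^ 2) i - (g i + β) ^ 2 := by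
    intro i
    have hexp : ∀ j, R.A i j * (1 + g j - g i - β) ^ 2 + R.B i j * (g j - g i - β) ^ 2 =
        R.A i j * 1 + 2 * (R.A i j * g j) - 2 * (g i + β) * (R.A i j * 1)
          + R.M i j * g j ^ 2 - 2 * (g i + β) * (R.M i j * g j) + (g i + β) ^ 2 * R.M i j := by
      intro j
      rw [M_apply]
      ring
    have hgi : ∑ j, R.M i j * g j = β + g i - ∑ j, R.A i j * 1 := hg i
    simp only [hexp, Finset.sum_add_distrib, Finset.sum_sub_distrib, ← Finset.mul_sum,
      sum_row_eq_one hR.mulVec_one i, hgi]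
    simp only [Matrix.mulVec, dotProduct, Pi.one_apply]
    ring
  have hid : ∑ i, p i * ∑ j, (R.A i j * (1 + g j - g i - β) ^ 2 + R.B i j * (g j - g i - β) ^ 2) =
      β - β ^ 2 + 2 * (p ⬝ᵥ (R.A *ᵥ g)) := by
    have hexp : ∀ i, p i * ((R.A *ᵥ 1) i + 2 * (R.A *ᵥ g) i + (R.M *ᵥ fun j => g j ^ 2) i
        - (g i + β) ^ 2) = p i * (R.A *ᵥ 1) i + 2 * (p i * (R.A *ᵥ g) i)
          + p i * (R.M *ᵥ fun j => g j ^ 2) i - p i * g i ^ 2 - 2 * β * (p i * g i)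
          - β ^ 2 * p i := fun i => by ring
    have hst : ∑ i, p i * (R.M *ᵥ fun j => g j ^ 2) i = ∑ i, p i * g i ^ 2 := by
      change p ⬝ᵥ (R.M *ᵥ fun j => g j ^ 2) = p ⬝ᵥ fun j => g j ^ 2
      rw [Matrix.dotProduct_mulVec, hR.vecMul]
    have hpg' : ∑ i, p i * g i = 0 := hpg
    have hβ' : ∑ i, p i * (R.A *ᵥ 1) i = β := hβ.symm
    simp only [hloc, hexp, Finset.sum_add_distrib, Finset.sum_sub_distrib, ← Finset.mul_sum,
      hst, hpg', hβ', hR.sum_eq_one]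
    simp only [dotProduct]
    ring
  rw [← hid]
  have hterm : ∀ i j, 0 ≤ R.A i j * (1 + g j - g i - β) ^ 2 + R.B i j * (g j - g i - β) ^ 2 :=
    fun i j => add_nonneg (mul_nonneg (R.A_nonneg i j) (sq_nonneg _))
      (mul_nonneg (R.B_nonneg i j) (sq_nonneg _))
  have hsum : ∀ i, 0 ≤ p i * ∑ j, (R.A i j * (1 + g j - g i - β) ^ 2
      + R.B i j * (g j - g i - β) ^ 2) := fun i =>
    mul_nonneg (hR.pos i).le (Finset.sum_nonneg fun j _ => hterm i j)
  refine lt_of_le_of_ne (Finset.sum_nonneg fun i _ => hsum i) fun h0 => ?_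
  have hall : ∀ i j, R.A i j * (1 + g j - g i - β) ^ 2 + R.B i j * (g j - g i - β) ^ 2 = 0 := by
    intro i j
    have h1 := (Finset.sum_eq_zero_iff_of_nonneg fun i _ => hsum i).mp h0.symm i (Finset.mem_univ i)
    have h2 := (mul_eq_zero.mp h1).resolve_left (hR.pos i).ne'
    exact (Finset.sum_eq_zero_iff_of_nonneg fun j _ => hterm i j).mp h2 j (Finset.mem_univ j)
  refine hR.aperiodic.not_potential g β (fun i j hij => ?_) (fun i j hij => ?_)
  · have h1 := hall i j
    have h2 : R.A i j * (1 + g j - g i - β) ^ 2 = 0 := le_antisymm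
      (by linarith [mul_nonneg (R.B_nonneg i j) (sq_nonneg (g j - g i - β))])
      (mul_nonneg hij.le (sq_nonneg _))
    have h3 := pow_eq_zero_iff (two_ne_zero) |>.mp ((mul_eq_zero.mp h2).resolve_left hij.ne')
    linarith
  · have h1 := hall i j
    have h2 : R.B i j * (g j - g i - β) ^ 2 = 0 := le_antisymm
      (by linarith [mul_nonneg (R.A_nonneg i j) (sq_nonneg (1 + g j - g i - β))])
      (mul_nonneg hij.le (sq_nonneg _))
    have h3 := pow_eq_zero_iff (two_ne_zero) |>.mp ((mul_eq_zero.mp h2).resolve_left hij.ne')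
    linarith

end IsStochastic

end LinRep

/-! ### Analytic perturbation of the Perron eigenvalue. -/

section

attribute [local instance] Matrix.linftyOpNormedRing Matrix.linftyOpNormedAlgebra

theorem analyticAt_inv_entry {ι : Type*} [Fintype ι] [DecidableEq ι] {W : ℂ → Matrix ι ι ℂ} {z₀ : ℂ}
    (hW : AnalyticAt ℂ W z₀) (hu : IsUnit (W z₀)) (i j : ι) :
    AnalyticAt ℂ (fun z => (W z)⁻¹ i j) z₀ := by
  obtain ⟨w, hw⟩ := hu
  have h1 : AnalyticAt ℂ (fun z => (W z)⁻¹) z₀ := by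
    have := (hw ▸ analyticAt_inverse (𝕜 := ℂ) w).comp hW
    simpa [Function.comp_def, Matrix.nonsing_inv_eq_ringInverse] using this
  let L : Matrix ι ι ℂ →L[ℂ] ℂ := LinearMap.toContinuousLinearMap (Matrix.entryLinearMap ℂ ℂ i j)
  exact (L.analyticAt _).comp h1

theorem LinRep.analyticAt_smul_one_sub_twist_add {ι : Type} [Fintype ι] [DecidableEq ι]
    (R : LinRep ι) {u : ℂ → ℂ} {z₀ : ℂ} (hu : AnalyticAt ℂ u z₀) (K : Matrix ι ι ℂ) :
    AnalyticAt ℂ (fun z => u z • (1 : Matrix ι ι ℂ) - R.twist z + K) z₀ := by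
  unfold LinRep.twist
  have h : AnalyticAt ℂ Complex.exp z₀ := by fun_prop
  exact ((hu.smul analyticAt_const).sub ((h.smul analyticAt_const).add analyticAt_const)).add
    analyticAt_const

end

namespace LinRep.IsStochastic

variable {ι : Type} [Fintype ι] [DecidableEq ι] {R : LinRep ι} {p : ι → ℝ}

/-- A kernel vector would be an eigenvector of `M - 1 p'` for the eigenvalue 1, beyond its spectral
radius. -/
theorem isUnit_one_sub (hR : R.IsStochastic p) :
    IsUnit ((1 : Matrix ι ι ℂ) - R.twist 0 + rankOne p) := by
  rw [Matrix.isUnit_iff_isUnit_det, isUnit_iff_ne_zero]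
  intro h
  obtain ⟨v, hv, hWv⟩ := Matrix.exists_mulVec_eq_zero_iff.mpr h
  have hNv : (R.M.map (algebraMap ℝ ℂ) - rankOne p) *ᵥ v = (1 : ℂ) • v := by
    rw [twist_zero, Matrix.add_mulVec, Matrix.sub_mulVec, Matrix.one_mulVec] at hWv
    rw [Matrix.sub_mulVec, one_smul, eq_comm, ← sub_eq_zero, ← hWv]
    abel
  have hne := hR.nonempty
  have h1 := hR.spectralRadius_sub_rankOne_lt_one
  obtain ⟨⟨μ, w, hw, hTw, hμ⟩, h2⟩ := exists_norm_eq_spectralRadius_toReal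
    (R.M.map (algebraMap ℝ ℂ) - rankOne p)
  have h3 := h2 1 v hv hNv
  have h4 := ENNReal.toReal_mono ENNReal.one_ne_top h1.le
  have h5 := (ENNReal.toReal_lt_toReal h1.ne_top ENNReal.one_ne_top).mpr h1
  simp only [norm_one, ENNReal.toReal_one] at h3 h5
  linarith

/-- Analytic right and left eigenvectors of `A e^z + B` for the eigenvalue `u z`. -/
theorem exists_analytic_eigenvectors (hR : R.IsStochastic p) {u : ℂ → ℂ} (hu : AnalyticAt ℂ u 0)
    (hu1 : u 0 = 1) (hdet : ∀ᶠ z in 𝓝 (0 : ℂ), (u z • (1 : Matrix ι ι ℂ) - R.twist z).det = 0) :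
    ∃ x y : ℂ → ι → ℂ, (∀ i, AnalyticAt ℂ (fun z => x z i) 0) ∧
      (∀ i, AnalyticAt ℂ (fun z => y z i) 0) ∧ (x 0 = fun i => (p i : ℂ)) ∧ y 0 = 1 ∧
      ∀ᶠ z in 𝓝 (0 : ℂ), (fun i => (p i : ℂ)) ⬝ᵥ y z = 1 ∧
        R.twist z *ᵥ y z = u z • y z ∧ x z ᵥ* R.twist z = u z • x z := by
  set pc : ι → ℂ := fun i => (p i : ℂ) with hpc
  -- The rank one term makes the singular matrix `u(z) I - Q(z)` invertible near 0. The eigenvectors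
  -- are then `W⁻¹ 1` and `p' W⁻¹`, analytic because matrix inversion is.
  set W : ℂ → Matrix ι ι ℂ := fun z => u z • (1 : Matrix ι ι ℂ) - R.twist z + rankOne p with hW
  have hWa := R.analyticAt_smul_one_sub_twist_add hu (rankOne p)
  have hW0 : IsUnit (W 0) := by
    simp only [hW, hu1, one_smul]
    exact hR.isUnit_one_sub
  have hent := analyticAt_inv_entry hWa hW0
  have hcont : ContinuousAt (fun z => (W z).det) 0 := by
    have hWc : ContinuousAt W 0 := by
      have h1 := hu.continuousAt
      have h2 : Continuous R.twist := by unfold LinRep.twist; fun_prop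
      have h3 := h2.continuousAt (x := (0 : ℂ))
      simp only [hW]
      fun_prop
    exact (Continuous.matrix_det continuous_id).continuousAt.comp hWc
  have hunit : ∀ᶠ z in 𝓝 (0 : ℂ), IsUnit (W z).det := by
    have h0 : (W 0).det ≠ 0 := by
      rwa [Matrix.isUnit_iff_isUnit_det, isUnit_iff_ne_zero] at hW0
    filter_upwards [hcont.eventually_ne h0] with z hz
    exact isUnit_iff_ne_zero.mpr hz
  have hW0' : IsUnit (W 0).det := (Matrix.isUnit_iff_isUnit_det _).mp hW0
  have hW0y : W 0 *ᵥ 1 = 1 := by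
    simp only [hW, hu1, one_smul, twist_zero]
    rw [Matrix.add_mulVec, Matrix.sub_mulVec, Matrix.one_mulVec, hR.cast_mulVec_one, sub_self,
      rankOne_mulVec, hR.cast_dotProduct_one, zero_add, one_smul]
  have hW0x : pc ᵥ* W 0 = pc := by
    simp only [hW, hu1, one_smul, twist_zero]
    rw [Matrix.vecMul_add, Matrix.vecMul_sub, Matrix.vecMul_one, hR.cast_vecMul, sub_self,
      vecMul_rankOne, hR.cast_dotProduct_one, zero_add, one_smul]
  refine ⟨fun z => pc ᵥ* (W z)⁻¹, fun z => (W z)⁻¹ *ᵥ 1, fun i => ?_, fun i => ?_, ?_, ?_, ?_⟩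
  · simp only [Matrix.vecMul, dotProduct]
    exact Finset.analyticAt_fun_sum _ fun j _ => analyticAt_const.mul (hent j i)
  · simp only [Matrix.mulVec, dotProduct]
    exact Finset.analyticAt_fun_sum _ fun j _ => (hent i j).mul analyticAt_const
  · change pc ᵥ* (W 0)⁻¹ = pc
    conv_lhs => rw [← hW0x]
    rw [Matrix.vecMul_vecMul, Matrix.mul_nonsing_inv _ hW0', Matrix.vecMul_one]
  · change (W 0)⁻¹ *ᵥ 1 = 1
    conv_lhs => rw [← hW0y]
    rw [Matrix.mulVec_mulVec, Matrix.nonsing_inv_mul _ hW0', Matrix.one_mulVec]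
  · filter_upwards [hunit, hdet] with z hz hd
    have hWy : W z *ᵥ ((W z)⁻¹ *ᵥ 1) = 1 := by
      rw [Matrix.mulVec_mulVec, Matrix.mul_nonsing_inv _ hz, Matrix.one_mulVec]
    have hxW : (pc ᵥ* (W z)⁻¹) ᵥ* W z = pc := by
      rw [Matrix.vecMul_vecMul, Matrix.nonsing_inv_mul _ hz, Matrix.vecMul_one]
    -- The determinant equation enters here. A null vector `v` of `u(z) I - Q(z)` satisfies `W v =
    -- (p ⬝ᵥ v) 1`, hence `v = (p ⬝ᵥ v) W⁻¹ 1`, which forces this normalisation; both eigenvector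
    -- relations follow from it.
    have hpy : pc ⬝ᵥ ((W z)⁻¹ *ᵥ 1) = 1 := by
      obtain ⟨v, hv, hv0⟩ := Matrix.exists_mulVec_eq_zero_iff.mpr hd
      have h1 : W z *ᵥ v = (pc ⬝ᵥ v) • 1 := by
        rw [hW, Matrix.add_mulVec, hv0, zero_add, rankOne_mulVec]
      have h2 : v = (pc ⬝ᵥ v) • ((W z)⁻¹ *ᵥ 1) := by
        rw [← Matrix.mulVec_smul, ← h1, Matrix.mulVec_mulVec, Matrix.nonsing_inv_mul _ hz,
          Matrix.one_mulVec]
      have h3 : pc ⬝ᵥ v ≠ 0 := by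
        intro h
        rw [h, zero_smul] at h2
        exact hv h2
      have h4 : pc ⬝ᵥ v = (pc ⬝ᵥ v) * (pc ⬝ᵥ ((W z)⁻¹ *ᵥ 1)) := by
        conv_lhs => rw [h2]
        rw [dotProduct_smul, smul_eq_mul]
      exact mul_left_cancel₀ h3 (h4.symm.trans (mul_one _).symm)
    refine ⟨hpy, ?_, ?_⟩
    · have h1 : W z *ᵥ ((W z)⁻¹ *ᵥ 1) = u z • ((W z)⁻¹ *ᵥ 1) - R.twist z *ᵥ ((W z)⁻¹ *ᵥ 1)
          + (pc ⬝ᵥ ((W z)⁻¹ *ᵥ 1)) • 1 := by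
        conv_lhs => rw [hW]
        rw [Matrix.add_mulVec, Matrix.sub_mulVec, rankOne_mulVec, Matrix.smul_mulVec,
          Matrix.one_mulVec]
      rw [hWy, hpy, one_smul, eq_comm, add_eq_right, sub_eq_zero] at h1
      exact h1.symm
    · have h1 : (pc ᵥ* (W z)⁻¹) ᵥ* W z = u z • (pc ᵥ* (W z)⁻¹) - (pc ᵥ* (W z)⁻¹) ᵥ* R.twist z
          + ((pc ᵥ* (W z)⁻¹) ⬝ᵥ 1) • pc := by
        conv_lhs => rw [hW]
        rw [Matrix.vecMul_add, Matrix.vecMul_sub, vecMul_rankOne, Matrix.vecMul_smul,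
          Matrix.vecMul_one]
      rw [hxW, ← Matrix.dotProduct_mulVec, hpy, one_smul, eq_comm, add_eq_right, sub_eq_zero] at h1
      exact h1.symm

end LinRep.IsStochastic

/-- The first two derivatives at `0` of `1 + (e^z - 1) φ(z)`. -/
theorem deriv_iteratedDeriv_two_of_eventuallyEq {u φ : ℂ → ℂ} (hφ : AnalyticAt ℂ φ 0)
    (h : u =ᶠ[𝓝 0] fun z => 1 + (Complex.exp z - 1) * φ z) :
    deriv u 0 = φ 0 ∧ iteratedDeriv 2 u 0 = φ 0 + 2 * deriv φ 0 := by
  have h1 : deriv u =ᶠ[𝓝 0] fun z => Complex.exp z * φ z + (Complex.exp z - 1) * deriv φ z := by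
    filter_upwards [h.eventuallyEq_nhds, hφ.eventually_analyticAt] with z hz hφz
    rw [hz.deriv_eq]
    have := (((Complex.hasDerivAt_exp z).sub_const 1).mul
      hφz.differentiableAt.hasDerivAt).const_add 1
    exact this.deriv
  refine ⟨by rw [h1.self_of_nhds]; simp, ?_⟩
  rw [iteratedDeriv_succ, iteratedDeriv_one, h1.deriv_eq]
  have h2 := ((Complex.hasDerivAt_exp 0).mul hφ.differentiableAt.hasDerivAt).add
    (((Complex.hasDerivAt_exp 0).sub_const 1).mul hφ.deriv.differentiableAt.hasDerivAt)
  refine h2.deriv.trans ?_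
  simp
  ring

/-- `Q = μ E + N` with `E N = N E = 0`, so the powers do not mix. The case `n = 0` is excluded,
where the right side would be `E + 1`. -/
theorem pow_eq_of_spectral_projection {ι : Type*} [Fintype ι] [DecidableEq ι]
    {Q E : Matrix ι ι ℂ} {μ : ℂ} (hQE : Q * E = μ • E)
    (hEQ : E * Q = μ • E) (hEE : E * E = E) {n : ℕ} (hn : 1 ≤ n) :
    Q ^ n = μ ^ n • E + (Q - μ • E) ^ n := by
  have hEN : E * (Q - μ • E) = 0 := by
    rw [mul_sub, hEQ, mul_smul_comm, hEE, sub_self]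
  have hNE : (Q - μ • E) * E = 0 := by
    rw [sub_mul, hQE, smul_mul_assoc, hEE, sub_self]
  induction n, hn using Nat.le_induction with
  | base => simp
  | succ n hn ih =>
    have h1 : (Q - μ • E) ^ n * E = 0 := by
      obtain ⟨m, rfl⟩ := Nat.exists_eq_add_of_le' hn
      rw [pow_succ, mul_assoc, hNE, mul_zero]
    calc Q ^ (n + 1) = (μ ^ n • E + (Q - μ • E) ^ n) * (μ • E + (Q - μ • E)) := by
          rw [pow_succ, ih]; congr 1; abel
      _ = _ := by
        rw [add_mul, mul_add, mul_add, smul_mul_smul_comm, hEE, smul_mul_assoc, hEN, smul_zero,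
          mul_smul_comm, h1, smul_zero, ← pow_succ, ← pow_succ]
        abel

namespace LinRep.IsStochastic

variable {ι : Type} [Fintype ι] [DecidableEq ι] {R : LinRep ι} {p : ι → ℝ}

omit [DecidableEq ι] in
theorem twist_mulVec (R : LinRep ι) (z : ℂ) (v : ι → ℂ) :
    R.twist z *ᵥ v = R.M.map (algebraMap ℝ ℂ) *ᵥ v
      + (Complex.exp z - 1) • (R.A.map (algebraMap ℝ ℂ) *ᵥ v) := by
  have : R.twist z = R.M.map (algebraMap ℝ ℂ) + (Complex.exp z - 1) • R.A.map (algebraMap ℝ ℂ) := by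
    ext i j
    simp [twist_apply, M_apply]
    ring
  rw [this, Matrix.add_mulVec, Matrix.smul_mulVec]

/-- The derivatives of the Perron branch at `0`: mean value and asymptotic variance. -/
theorem exists_mean_variance (hR : R.IsStochastic p) {u : ℂ → ℂ} (hu : AnalyticAt ℂ u 0)
    (hu1 : u 0 = 1) (hdet : ∀ᶠ z in 𝓝 (0 : ℂ), (u z • (1 : Matrix ι ι ℂ) - R.twist z).det = 0) :
    ∃ β γ : ℝ, deriv u 0 = β ∧ iteratedDeriv 2 u 0 = γ + (β : ℂ) ^ 2 ∧ 0 < β ∧ β < 1 ∧ 0 < γ := by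
  obtain ⟨_, y, _, hy, _, hy0, hev⟩ := hR.exists_analytic_eigenvectors hu hu1 hdet
  set pc : ι → ℂ := fun i => (p i : ℂ) with hpc
  set Ac := R.A.map (algebraMap ℝ ℂ) with hAc
  set Mc := R.M.map (algebraMap ℝ ℂ) with hMc
  set φ : ℂ → ℂ := fun z => pc ⬝ᵥ (Ac *ᵥ y z) with hφdef
  set h : ι → ℂ := fun i => deriv (fun z => y z i) 0
  have hyd : ∀ i, HasDerivAt (fun z => y z i) (h i) 0 := fun i => (hy i).differentiableAt.hasDerivAt
  have hmul : ∀ (T : Matrix ι ι ℂ) (i : ι),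
      HasDerivAt (fun z => (T *ᵥ y z) i) ((T *ᵥ h) i) 0 := fun T i =>
    HasDerivAt.fun_sum fun j _ => (hyd j).const_mul (T i j)
  have hdot : ∀ T : Matrix ι ι ℂ,
      HasDerivAt (fun z => pc ⬝ᵥ (T *ᵥ y z)) (pc ⬝ᵥ (T *ᵥ h)) 0 := fun T =>
    HasDerivAt.fun_sum fun i _ => (hmul T i).const_mul (pc i)
  have hφ : AnalyticAt ℂ φ 0 := by
    simp only [hφdef, Matrix.mulVec, dotProduct]
    exact Finset.analyticAt_fun_sum _ fun i _ => analyticAt_const.mul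
      (Finset.analyticAt_fun_sum _ fun j _ => analyticAt_const.mul (hy j))
  -- Pairing `Q(z) y = u y` with the stationary `p` isolates the factor `e^z - 1`, so that `u''(0)`
  -- involves only the first derivative of `y`.
  have huφ : u =ᶠ[𝓝 0] fun z => 1 + (Complex.exp z - 1) * φ z := by
    filter_upwards [hev] with z ⟨h1, h2, _⟩
    have h3 := congrArg (fun x => pc ⬝ᵥ x) h2
    simp only [twist_mulVec, dotProduct_add, dotProduct_smul, h1, smul_eq_mul, mul_one] at h3
    rw [Matrix.dotProduct_mulVec, hR.cast_vecMul, h1] at h3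
    exact h3.symm
  obtain ⟨hd1, hd2⟩ := deriv_iteratedDeriv_two_of_eventuallyEq hφ huφ
  set β : ℝ := p ⬝ᵥ (R.A *ᵥ 1) with hβ
  have hone : (fun i => ((1 : ι → ℝ) i : ℂ)) = 1 := by
    funext i
    simp
  have hcast : ∀ x : ι → ℝ, pc ⬝ᵥ (Ac *ᵥ fun i => (x i : ℂ)) = ((p ⬝ᵥ (R.A *ᵥ x) : ℝ) : ℂ) := by
    intro x
    rw [hAc, map_mulVec_ofReal]
    simp [dotProduct, hpc]
  have hφ0 : φ 0 = β := by
    simp only [hφdef, hy0]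
    rw [← hone, hcast]
  have hAc1 : ∀ i, (Ac *ᵥ 1) i = ((R.A *ᵥ 1) i : ℂ) := fun i => by
    rw [hAc, ← hone, map_mulVec_ofReal]
  have hud : HasDerivAt u β 0 := by
    rw [← hφ0, ← hd1]
    exact hu.differentiableAt.hasDerivAt
  -- Differentiating the eigenvector equation at 0 gives the Poisson equation for `h = y'(0)`.
  have hpoisson : ∀ i, (Mc *ᵥ h) i = β + h i - (R.A *ᵥ 1) i := by
    intro i
    have h1 := (hmul Mc i).add (((Complex.hasDerivAt_exp 0).sub_const 1).mul (hmul Ac i))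
    have h2 := hud.mul (hyd i)
    have h3 : (fun z => (Mc *ᵥ y z) i + (Complex.exp z - 1) * (Ac *ᵥ y z) i)
        =ᶠ[𝓝 0] fun z => u z * y z i := by
      filter_upwards [hev] with z ⟨_, hz, _⟩
      have := congrFun hz i
      rwa [twist_mulVec] at this
    have h4 := (h1.congr_of_eventuallyEq h3.symm).unique h2
    simp only [Complex.exp_zero, one_mul, sub_self, zero_mul, add_zero, hy0, hu1, Pi.one_apply,
      mul_one, hAc1] at h4
    linear_combination h4
  have hph : pc ⬝ᵥ h = 0 := by
    have h1 := hdot 1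
    simp only [Matrix.one_mulVec] at h1
    have h2 : (fun z => pc ⬝ᵥ y z) =ᶠ[𝓝 0] fun _ => (1 : ℂ) := by
      filter_upwards [hev] with z hz using hz.1
    exact (h1.congr_of_eventuallyEq h2.symm).unique (hasDerivAt_const 0 1)
  set g : ι → ℝ := fun i => (h i).re with hg
  set q : ι → ℝ := fun i => (h i).im with hq
  have hMre : ∀ i, ((Mc *ᵥ h) i).re = (R.M *ᵥ g) i := fun i => by
    simp [Matrix.mulVec, dotProduct, hMc, hg]
  have hMim : ∀ i, ((Mc *ᵥ h) i).im = (R.M *ᵥ q) i := fun i => by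
    simp [Matrix.mulVec, dotProduct, hMc, hq]
  have hpg : p ⬝ᵥ g = 0 := by
    have := congrArg Complex.re hph
    simpa [dotProduct, hpc] using this
  have hpq : p ⬝ᵥ q = 0 := by
    have := congrArg Complex.im hph
    simpa [dotProduct, hpc] using this
  -- The Poisson equation has real data, so the imaginary part of `h` is fixed by `M` and orthogonal
  -- to `p`; hence `h` is real.
  have hq0 : (fun i => (q i : ℂ)) = 0 := by
    refine hR.eq_zero_of_eigenvector (μ := 1) (by simp) ?_ ?_
    · rw [map_mulVec_ofReal, one_smul]
      funext i
      rw [← hMim, hpoisson]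
      simp [hq]
    · have := congrArg (fun x : ℝ => (x : ℂ)) hpq
      simpa [dotProduct] using this
  have hhg : h = fun i => (g i : ℂ) := by
    funext i
    have := congrFun hq0 i
    refine Complex.ext (by simp [hg]) ?_
    simpa [hq] using this
  have hφ' : deriv φ 0 = ((p ⬝ᵥ (R.A *ᵥ g) : ℝ) : ℂ) := by
    rw [(hdot Ac).deriv, hhg, hcast]
  have hmem := hR.sum_mul_sum_A_mem
  refine ⟨β, β - β ^ 2 + 2 * (p ⬝ᵥ (R.A *ᵥ g)), by rw [hd1, hφ0], ?_, hmem.1, hmem.2,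
    hR.variance_pos hβ (fun i => ?_) hpg⟩
  · rw [hd2, hφ0, hφ']
    push_cast
    ring
  · rw [← hMre, hpoisson]
    simp [hg]

/-- The bilinear forms of the powers of `A e^z + B` near `z = 0`: a leading term, analytic in `z`,
and an exponentially small remainder. -/
theorem exists_bilin_twist_pow (hR : R.IsStochastic p) {u : ℂ → ℂ} (hu : AnalyticAt ℂ u 0)
    (hu1 : u 0 = 1) (hdet : ∀ᶠ z in 𝓝 (0 : ℂ), (u z • (1 : Matrix ι ι ℂ) - R.twist z).det = 0)
    (ξ η : ι → ℂ) :
    ∃ s : ℂ → ℂ, AnalyticAt ℂ s 0 ∧ s 0 = (ξ ⬝ᵥ 1) * ((fun i => (p i : ℂ)) ⬝ᵥ η) ∧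
      ∃ C ρ : ℝ, 0 < ρ ∧ ρ < 1 ∧ 0 ≤ C ∧ ∀ᶠ z in 𝓝 (0 : ℂ), ∀ n : ℕ, 1 ≤ n →
        ‖ξ ⬝ᵥ (R.twist z ^ n *ᵥ η) - u z ^ n * s z‖ ≤ C * ρ ^ n := by
  obtain ⟨x, y, hx, hy, hx0, hy0, hev⟩ := hR.exists_analytic_eigenvectors hu hu1 hdet
  have hdot : ∀ v w : ℂ → ι → ℂ, (∀ i, AnalyticAt ℂ (fun z => v z i) 0) →
      (∀ i, AnalyticAt ℂ (fun z => w z i) 0) → AnalyticAt ℂ (fun z => v z ⬝ᵥ w z) 0 :=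
    fun v w hv hw => Finset.analyticAt_fun_sum _ fun i _ => (hv i).mul (hw i)
  have hxy := hdot x y hx hy
  have hxy0 : x 0 ⬝ᵥ y 0 = 1 := by rw [hx0, hy0, hR.cast_dotProduct_one]
  have hxyne : ∀ᶠ z in 𝓝 (0 : ℂ), x z ⬝ᵥ y z ≠ 0 :=
    hxy.continuousAt.eventually_ne (by rw [hxy0]; exact one_ne_zero)
  -- `E z` is the spectral projection of `Q(z)` for `u z`. The rest `Q - u E` equals `M - 1 p'` at
  -- `z = 0`, so its powers decay uniformly nearby.
  set E : ℂ → Matrix ι ι ℂ := fun z => (x z ⬝ᵥ y z)⁻¹ • Matrix.vecMulVec (y z) (x z) with hE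
  have hs : ∀ z, ξ ⬝ᵥ (E z *ᵥ η) = (x z ⬝ᵥ y z)⁻¹ * ((ξ ⬝ᵥ y z) * (x z ⬝ᵥ η)) := by
    intro z
    simp only [hE]
    rw [Matrix.smul_mulVec, dotProduct_smul, Matrix.vecMulVec_mulVec]
    simp [dotProduct_smul, mul_comm]
  have hN0 : R.twist 0 - u 0 • E 0 = R.M.map (algebraMap ℝ ℂ) - rankOne p := by
    simp only [hE]
    rw [twist_zero, hu1, hxy0, hx0, hy0, inv_one, one_smul, one_smul, rankOne]
  have hNc : ContinuousAt (fun z => R.twist z - u z • E z) 0 := by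
    have h2 : Continuous R.twist := by unfold LinRep.twist; fun_prop
    have h3 : ContinuousAt y 0 := continuousAt_pi.mpr fun i => (hy i).continuousAt
    have h4 : ContinuousAt x 0 := continuousAt_pi.mpr fun i => (hx i).continuousAt
    have h5 : ContinuousAt (fun z => Matrix.vecMulVec (y z) (x z)) 0 :=
      continuousAt_pi.mpr fun i => continuousAt_pi.mpr fun j =>
        (hy i).continuousAt.mul (hx j).continuousAt
    exact h2.continuousAt.sub (hu.continuousAt.smul
      ((hxy.continuousAt.inv₀ (by rw [hxy0]; exact one_ne_zero)).smul h5))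
  obtain ⟨C, ρ, hρ0, hρ1, hC, hbd⟩ := exists_bilin_pow_bound hNc
    (by rw [hN0]; exact hR.spectralRadius_sub_rankOne_lt_one) ξ η
  refine ⟨fun z => (x z ⬝ᵥ y z)⁻¹ * ((ξ ⬝ᵥ y z) * (x z ⬝ᵥ η)), ?_, ?_, C, ρ, hρ0, hρ1, hC, ?_⟩
  · exact (hxy.inv (by rw [hxy0]; exact one_ne_zero)).mul
      ((hdot (fun _ => ξ) y (fun _ => analyticAt_const) hy).mul
        (hdot x (fun _ => η) hx fun _ => analyticAt_const))
  · simp only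
    rw [hxy0, hx0, hy0, inv_one, one_mul]
  · filter_upwards [hev, hxyne, hbd] with z ⟨_, hQy, hxQ⟩ hne hz n hn
    have hQE : R.twist z * E z = u z • E z := by
      simp only [hE]
      rw [mul_smul_comm, Matrix.mul_vecMulVec, hQy, Matrix.smul_vecMulVec, smul_comm]
    have hEQ : E z * R.twist z = u z • E z := by
      simp only [hE]
      rw [smul_mul_assoc, Matrix.vecMulVec_mul, hxQ, Matrix.vecMulVec_smul, smul_comm]
    have hEE : E z * E z = E z := by
      simp only [hE]
      rw [smul_mul_smul_comm, Matrix.vecMulVec_mul_vecMulVec, Matrix.vecMulVec_smul, smul_smul]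
      congr 1
      field_simp
    have h1 := hz n
    rwa [← hs, pow_eq_of_spectral_projection hQE hEQ hEE hn, Matrix.add_mulVec, dotProduct_add,
      Matrix.smul_mulVec, dotProduct_smul, smul_eq_mul, add_sub_cancel_left]

end LinRep.IsStochastic

/-! ### Comparison of the branch with a Gaussian exponential. -/

section Taylor

/-- An analytic function and the Gaussian-type exponential with the same derivatives up to order
two at `0` differ by `O(θ³)` along the imaginary axis. -/
theorem exists_norm_sub_cexp_le {u : ℂ → ℂ} {β γ : ℝ} (hu : AnalyticAt ℂ u 0) (hu0 : u 0 = 1)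
    (hu1 : deriv u 0 = β) (hu2 : iteratedDeriv 2 u 0 = γ + (β : ℂ) ^ 2) :
    ∃ K : ℝ, 0 ≤ K ∧ ∀ᶠ θ : ℝ in 𝓝 0,
      ‖u (θ * Complex.I) - Complex.exp (β * θ * Complex.I - γ * θ ^ 2 / 2)‖ ≤ K * |θ| ^ 3 := by
  set g : ℂ → ℂ := fun z => Complex.exp (β * z + γ / 2 * z ^ 2) with hg
  have hga : AnalyticAt ℂ g 0 := by
    simp only [hg]
    fun_prop
  have hgd : ∀ z, HasDerivAt g (g z * (β + γ * z)) z := by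
    intro z
    have h1 : HasDerivAt (fun z : ℂ => β * z + γ / 2 * z ^ 2) (β + γ * z) z := by
      have := ((hasDerivAt_id z).const_mul (β : ℂ)).add
        (((hasDerivAt_id z).pow 2).const_mul ((γ : ℂ) / 2))
      refine this.congr_deriv ?_
      simp
      ring
    exact h1.cexp
  have hg0 : g 0 = 1 := by simp [hg]
  have hg1 : deriv g = fun z => g z * (β + γ * z) := funext fun z => (hgd z).deriv
  have hg2 : iteratedDeriv 2 g 0 = γ + (β : ℂ) ^ 2 := by
    rw [iteratedDeriv_succ, iteratedDeriv_one, hg1]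
    have := (hgd 0).mul (((hasDerivAt_id (0 : ℂ)).const_mul (γ : ℂ)).const_add (β : ℂ))
    refine this.deriv.trans ?_
    simp [hg0]
    ring
  have hdiff : AnalyticAt ℂ (fun z => u z - g z) 0 := hu.fun_sub hga
  have horder : ((3 : ℕ) : ℕ∞) ≤ analyticOrderAt (fun z => u z - g z) 0 := by
    rw [natCast_le_analyticOrderAt_iff_iteratedDeriv_eq_zero hdiff]
    intro i hi
    rw [iteratedDeriv_fun_sub hu.contDiffAt hga.contDiffAt, sub_eq_zero]
    interval_cases i
    · simp [hu0, hg0]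
    · simp [hu1, hg1, hg0]
    · rw [hu2, hg2]
  obtain ⟨F, hFa, hF⟩ := (natCast_le_analyticOrderAt hdiff).mp horder
  have hcont : ContinuousAt (fun θ : ℝ => (θ : ℂ) * Complex.I) 0 := by fun_prop
  have ht : Tendsto (fun θ : ℝ => (θ : ℂ) * Complex.I) (𝓝 0) (𝓝 0) := by
    simpa using hcont.tendsto
  have hFb : ∀ᶠ z in 𝓝 (0 : ℂ), ‖F z‖ < ‖F 0‖ + 1 :=
    hFa.continuousAt.norm.eventually (gt_mem_nhds (by linarith))
  refine ⟨‖F 0‖ + 1, by positivity, ?_⟩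
  filter_upwards [ht.eventually hF, ht.eventually hFb] with θ h1 h2
  have h3 : g (θ * Complex.I) = Complex.exp (β * θ * Complex.I - γ * θ ^ 2 / 2) := by
    simp only [hg]
    congr 1
    rw [mul_pow, Complex.I_sq]
    ring
  rw [← h3, h1, sub_zero, norm_smul, norm_pow, norm_mul, Complex.norm_I, Complex.norm_real, mul_one,
    Real.norm_eq_abs, mul_comm]
  gcongr

/-- The modulus of a function agreeing with the Gaussian-type exponential up to `O(θ³)`. -/
theorem eventually_norm_le_exp {f : ℝ → ℂ} {β γ K : ℝ} (hγ : 0 < γ) (hK : 0 ≤ K)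
    (h : ∀ᶠ θ : ℝ in 𝓝 0,
      ‖f θ - Complex.exp (β * θ * Complex.I - γ * θ ^ 2 / 2)‖ ≤ K * |θ| ^ 3) :
    ∀ᶠ θ : ℝ in 𝓝 0, ‖f θ‖ ≤ Real.exp (-(γ / 4) * θ ^ 2) := by
  have h1 : ∀ᶠ θ : ℝ in 𝓝 0, |θ| < γ / (8 * (K + 1)) := by
    have : Tendsto (fun θ : ℝ => |θ|) (𝓝 0) (𝓝 0) := by simpa using (continuous_abs.tendsto (0 : ℝ))
    exact this.eventually (gt_mem_nhds (by positivity))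
  have h2 : ∀ᶠ θ : ℝ in 𝓝 0, γ * θ ^ 2 < 1 := by
    have : Tendsto (fun θ : ℝ => γ * θ ^ 2) (𝓝 0) (𝓝 0) := by
      have hc : Continuous fun θ : ℝ => γ * θ ^ 2 := by fun_prop
      simpa using hc.tendsto 0
    exact this.eventually (gt_mem_nhds one_pos)
  filter_upwards [h, h1, h2] with θ hθ hθ1 hθ2
  have hg : ‖Complex.exp (β * θ * Complex.I - γ * θ ^ 2 / 2)‖ = Real.exp (-(γ * θ ^ 2 / 2)) := by
    rw [Complex.norm_exp]
    congr 1
    simp [← Complex.ofReal_pow]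
  have h3 : ‖f θ‖ ≤ Real.exp (-(γ * θ ^ 2 / 2)) + K * |θ| ^ 3 := by
    rw [← hg]
    calc ‖f θ‖ ≤ ‖Complex.exp (β * θ * Complex.I - γ * θ ^ 2 / 2)‖ +
          ‖f θ - Complex.exp (β * θ * Complex.I - γ * θ ^ 2 / 2)‖ := norm_le_norm_add_norm_sub' _ _
      _ ≤ _ := by gcongr
  refine h3.trans ?_
  -- Half of the Gaussian rate is given up to absorb the cubic error: `e^{-2t} + t/2 ≤ e^{-t}` for
  -- `0 ≤ t ≤ 1/4`.
  set t := γ / 4 * θ ^ 2 with ht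
  have ht0 : 0 ≤ t := by positivity
  have h4 : K * |θ| ^ 3 ≤ t / 2 := by
    rw [lt_div_iff₀ (by positivity)] at hθ1
    have : K * |θ| ≤ γ / 8 := by nlinarith [abs_nonneg θ]
    calc K * |θ| ^ 3 = K * |θ| * θ ^ 2 := by rw [← sq_abs θ]; ring
      _ ≤ γ / 8 * θ ^ 2 := by gcongr
      _ = t / 2 := by rw [ht]; ring
  have e1 : -(γ * θ ^ 2 / 2) = -t + -t := by rw [ht]; ring
  have e2 : -(γ / 4) * θ ^ 2 = -t := by rw [ht]; ring
  rw [e1, e2, Real.exp_add]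
  have h5 : Real.exp (-t) * Real.exp t = 1 := by rw [← Real.exp_add]; simp
  have h6 := Real.add_one_le_exp t
  have h7 := Real.add_one_le_exp (-t)
  have h8 := Real.exp_pos (-t)
  have h9 : t ≤ 1 / 4 := by rw [ht]; linarith
  have h10 : (3 / 4 : ℝ) ≤ Real.exp (-t) := by linarith
  have h11 : Real.exp (-t) * (1 - Real.exp (-t)) = Real.exp (-t) ^ 2 * (Real.exp t - 1) := by
    linear_combination (-Real.exp (-t)) * h5
  have h12 : 1 / 2 ≤ Real.exp (-t) ^ 2 := by nlinarith
  have h13 : t / 2 ≤ Real.exp (-t) ^ 2 * (Real.exp t - 1) := by nlinarith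
  nlinarith

end Taylor

/-- Comparison of the powers of two numbers of modulus at most `m`. -/
theorem norm_pow_sub_pow_le {a b : ℂ} {m : ℝ} (ha : ‖a‖ ≤ m) (hb : ‖b‖ ≤ m) (n : ℕ) :
    ‖a ^ n - b ^ n‖ ≤ n * ‖a - b‖ * m ^ (n - 1) := by
  have hm : 0 ≤ m := (norm_nonneg _).trans ha
  rw [← (Commute.all a b).geom_sum₂_mul, norm_mul, mul_right_comm, mul_comm]
  rw [mul_comm]
  gcongr
  refine (norm_sum_le _ _).trans ?_
  calc ∑ i ∈ Finset.range n, ‖a ^ i * b ^ (n - 1 - i)‖ ≤ ∑ i ∈ Finset.range n, m ^ (n - 1) := by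
        refine Finset.sum_le_sum fun i hi => ?_
        rw [norm_mul, norm_pow, norm_pow]
        have : n - 1 = i + (n - 1 - i) := by
          have := Finset.mem_range.mp hi
          omega
        conv_rhs => rw [this, pow_add]
        gcongr
    _ = _ := by simp

/-! ### Estimates of the characteristic function. -/

namespace LinRep.IsStochastic

variable {ι : Type} [Fintype ι] [DecidableEq ι] {R : LinRep ι} {p : ι → ℝ}

/-- The leading term is `u^n s`. Replacing `s` by `s(0)` costs `O(|θ|)`, and replacing `u^n` by the
Gaussian power costs `n |θ|³ e^{-γnθ²/4}`. Halving the rate to `γ/8` absorbs the factor `nθ²`. -/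
theorem exists_char_bound_near (hR : R.IsStochastic p) {u : ℂ → ℂ} (hu : AnalyticAt ℂ u 0)
    (hu0 : u 0 = 1) (hdet : ∀ᶠ z in 𝓝 (0 : ℂ), (u z • (1 : Matrix ι ι ℂ) - R.twist z).det = 0)
    {β γ : ℝ} (hγ : 0 < γ) (hu1 : deriv u 0 = β)
    (hu2 : iteratedDeriv 2 u 0 = γ + (β : ℂ) ^ 2) (ξ η : ι → ℂ) :
    ∃ K ρ : ℝ, 0 ≤ K ∧ 0 < ρ ∧ ρ < 1 ∧ ∀ᶠ θ : ℝ in 𝓝 0, ∀ n : ℕ, 1 ≤ n →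
      ‖ξ ⬝ᵥ (R.twist (θ * Complex.I) ^ n *ᵥ η) - (ξ ⬝ᵥ 1) * ((fun i => (p i : ℂ)) ⬝ᵥ η) *
        Complex.exp (β * θ * Complex.I - γ * θ ^ 2 / 2) ^ n‖
        ≤ K * (|θ| * Real.exp (-(γ / 8) * n * θ ^ 2)) + K * ρ ^ n := by
  set c : ℂ := (ξ ⬝ᵥ 1) * ((fun i => (p i : ℂ)) ⬝ᵥ η) with hc
  obtain ⟨s, hs, hs0, C, ρ, hρ0, hρ1, hC, hev⟩ := hR.exists_bilin_twist_pow hu hu0 hdet ξ η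
  rw [← hc] at hs0
  obtain ⟨K₃, hK₃, hT⟩ := exists_norm_sub_cexp_le hu hu0 hu1 hu2
  have hN := eventually_norm_le_exp (f := fun θ => u (θ * Complex.I)) hγ hK₃ hT
  have ht : Tendsto (fun θ : ℝ => (θ : ℂ) * Complex.I) (𝓝 0) (𝓝 0) := by
    have hcont : ContinuousAt (fun θ : ℝ => (θ : ℂ) * Complex.I) 0 := by fun_prop
    simpa using hcont.tendsto
  obtain ⟨L, hL⟩ := hs.differentiableAt.isBigO_sub.bound
  have h1 : ∀ᶠ θ : ℝ in 𝓝 0, |θ| < 1 := by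
    have : Tendsto (fun θ : ℝ => |θ|) (𝓝 0) (𝓝 0) := by simpa using (continuous_abs.tendsto (0 : ℝ))
    exact this.eventually (gt_mem_nhds one_pos)
  have hL0 : ∀ᶠ θ : ℝ in 𝓝 0, ‖s (θ * Complex.I) - c‖ ≤ |L| * |θ| := by
    filter_upwards [ht.eventually hL] with θ hθ
    rw [hs0, sub_zero, norm_mul, Complex.norm_I, mul_one, Complex.norm_real, Real.norm_eq_abs] at hθ
    exact hθ.trans (mul_le_mul_of_nonneg_right (le_abs_self L) (abs_nonneg θ))
  refine ⟨C + |L| + ‖c‖ * (K₃ * Real.exp (γ / 4) * (8 / γ)), ρ, by positivity, hρ0, hρ1, ?_⟩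
  filter_upwards [ht.eventually hev, hL0, hT, hN, h1] with θ e1 e2 e3 e4 e5 n hn
  set f := u (θ * Complex.I) with hf
  set g := Complex.exp (β * θ * Complex.I - γ * θ ^ 2 / 2) with hg
  set m := Real.exp (-(γ / 4) * θ ^ 2) with hm
  have hgm : ‖g‖ ≤ m := by
    rw [hg, Complex.norm_exp, hm]
    apply Real.exp_le_exp.mpr
    simp only [Complex.sub_re, Complex.mul_re, Complex.mul_im, Complex.ofReal_re, Complex.ofReal_im,
      Complex.I_re, Complex.I_im]
    simp [← Complex.ofReal_pow]
    nlinarith [mul_nonneg hγ.le (sq_nonneg θ)]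
  have hm0 : 0 < m := Real.exp_pos _
  have hmn : m ^ n = Real.exp (-(γ / 8) * n * θ ^ 2) * Real.exp (-(γ / 8 * n * θ ^ 2)) := by
    rw [hm, ← Real.exp_nat_mul, ← Real.exp_add]
    congr 1
    ring
  set b := Real.exp (-(γ / 8) * n * θ ^ 2) with hb
  have hb0 : 0 < b := Real.exp_pos _
  have hmb : m ^ n ≤ b := by
    rw [hmn]
    refine mul_le_of_le_one_right hb0.le (Real.exp_le_one_iff.mpr ?_)
    have : 0 ≤ γ / 8 * n * θ ^ 2 := by positivity
    linarith
  -- Since `|θ| < 1`, restoring the missing power of `m` costs at most `e^{γ/4}`.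
  have hm1 : m ^ (n - 1) ≤ Real.exp (γ / 4) * m ^ n := by
    have h2 : m ^ n = m ^ (n - 1) * m := by rw [← pow_succ, Nat.sub_add_cancel hn]
    have h3 : 1 ≤ Real.exp (γ / 4) * m := by
      rw [hm, ← Real.exp_add]
      refine Real.one_le_exp ?_
      have : θ ^ 2 ≤ 1 := by
        rw [← sq_abs]
        nlinarith [abs_nonneg θ]
      nlinarith
    rw [h2]
    calc m ^ (n - 1) = m ^ (n - 1) * 1 := (mul_one _).symm
      _ ≤ m ^ (n - 1) * (Real.exp (γ / 4) * m) := by gcongr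
      _ = _ := by ring
  have hte : n * θ ^ 2 * m ^ n ≤ 8 / γ * b := by
    set t := γ / 8 * n * θ ^ 2 with ht
    have h2 : t * Real.exp (-t) ≤ 1 := by
      have h3 := Real.add_one_le_exp t
      have h4 : Real.exp t * Real.exp (-t) = 1 := by rw [← Real.exp_add]; simp
      have h5 := Real.exp_pos (-t)
      nlinarith
    have h3 : n * θ ^ 2 = 8 / γ * t := by rw [ht]; field_simp
    rw [hmn, h3]
    calc 8 / γ * t * (b * Real.exp (-t)) = 8 / γ * b * (t * Real.exp (-t)) := by ring
      _ ≤ 8 / γ * b * 1 := by gcongr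
      _ = _ := mul_one _
  have hpow : ‖f ^ n - g ^ n‖ ≤ K₃ * Real.exp (γ / 4) * (8 / γ) * (|θ| * b) := by
    calc ‖f ^ n - g ^ n‖ ≤ n * ‖f - g‖ * m ^ (n - 1) := norm_pow_sub_pow_le e4 hgm n
      _ ≤ n * (K₃ * |θ| ^ 3) * (Real.exp (γ / 4) * m ^ n) := by gcongr
      _ = K₃ * Real.exp (γ / 4) * |θ| * (n * θ ^ 2 * m ^ n) := by rw [← sq_abs θ]; ring
      _ ≤ K₃ * Real.exp (γ / 4) * |θ| * (8 / γ * b) := by gcongr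
      _ = _ := by ring
  have hfn : ‖f ^ n‖ ≤ b := by
    rw [norm_pow]
    exact (pow_le_pow_left₀ (norm_nonneg _) e4 n).trans hmb
  have hmain : ‖f ^ n * s (θ * Complex.I) - c * g ^ n‖ ≤
      (|L| + ‖c‖ * (K₃ * Real.exp (γ / 4) * (8 / γ))) * (|θ| * b) := by
    calc ‖f ^ n * s (θ * Complex.I) - c * g ^ n‖
        = ‖f ^ n * (s (θ * Complex.I) - c) + c * (f ^ n - g ^ n)‖ := by congr 1; ring
      _ ≤ ‖f ^ n * (s (θ * Complex.I) - c)‖ + ‖c * (f ^ n - g ^ n)‖ := norm_add_le _ _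
      _ ≤ b * (|L| * |θ|) + ‖c‖ * (K₃ * Real.exp (γ / 4) * (8 / γ) * (|θ| * b)) := by
        rw [norm_mul, norm_mul]
        gcongr
      _ = _ := by ring
  have hθb : 0 ≤ |θ| * b := by positivity
  have hρn : 0 ≤ ρ ^ n := by positivity
  have hpos : 0 ≤ ‖c‖ * (K₃ * Real.exp (γ / 4) * (8 / γ)) := by positivity
  calc _ = ‖(ξ ⬝ᵥ (R.twist (θ * Complex.I) ^ n *ᵥ η) - f ^ n * s (θ * Complex.I)) +
        (f ^ n * s (θ * Complex.I) - c * g ^ n)‖ := by congr 1; ring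
    _ ≤ C * ρ ^ n + (|L| + ‖c‖ * (K₃ * Real.exp (γ / 4) * (8 / γ))) * (|θ| * b) :=
      (norm_add_le _ _).trans (add_le_add (e1 n hn) hmain)
    _ ≤ _ := by
      have := mul_nonneg hC hθb
      have := mul_nonneg (add_nonneg (abs_nonneg L) hpos) hρn
      linarith

theorem exp_mul_I_ne_one {θ : ℝ} (h0 : θ ≠ 0) (h1 : |θ| ≤ Real.pi) :
    Complex.exp (θ * Complex.I) ≠ 1 := by
  intro h
  obtain ⟨n, hn⟩ := Complex.exp_eq_one_iff.mp h
  have h2 : θ = n * (2 * Real.pi) := by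
    have := congrArg Complex.im hn
    simpa using this
  have hn0 : n ≠ 0 := by
    rintro rfl
    simp at h2
    exact h0 h2
  have h3 : (1 : ℝ) ≤ |(n : ℝ)| := by exact_mod_cast Int.one_le_abs hn0
  rw [h2, abs_mul, abs_of_pos Real.two_pi_pos] at h1
  nlinarith [Real.pi_pos]

/-- The generating function of `|w|_a` over the words of length `n`, on the unit circle, is close to
the characteristic function of a Gaussian. -/
theorem exists_char_bound (hR : R.IsStochastic p) {u : ℂ → ℂ} (hu : AnalyticAt ℂ u 0)
    (hu0 : u 0 = 1) (hdet : ∀ᶠ z in 𝓝 (0 : ℂ), (u z • (1 : Matrix ι ι ℂ) - R.twist z).det = 0)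
    {β γ : ℝ} (hγ : 0 < γ) (hu1 : deriv u 0 = β)
    (hu2 : iteratedDeriv 2 u 0 = γ + (β : ℂ) ^ 2) (ξ η : ι → ℂ) :
    ∃ K ρ : ℝ, 0 ≤ K ∧ 0 < ρ ∧ ρ < 1 ∧ ∀ n : ℕ, 1 ≤ n → ∀ θ : ℝ, |θ| ≤ Real.pi →
      ‖ξ ⬝ᵥ (R.twist (θ * Complex.I) ^ n *ᵥ η) - (ξ ⬝ᵥ 1) * ((fun i => (p i : ℂ)) ⬝ᵥ η) *
        Complex.exp (β * θ * Complex.I - γ * θ ^ 2 / 2) ^ n‖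
        ≤ K * (|θ| * Real.exp (-(γ / 8) * n * θ ^ 2)) + K * ρ ^ n := by
  set c : ℂ := (ξ ⬝ᵥ 1) * ((fun i => (p i : ℂ)) ⬝ᵥ η) with hc
  obtain ⟨K, ρ, hK, hρ0, hρ1, hev⟩ := hR.exists_char_bound_near hu hu0 hdet hγ hu1 hu2 ξ η
  obtain ⟨δ, hδ, hnear⟩ := Metric.eventually_nhds_iff.mp hev
  -- Away from 0 no comparison is needed: on this compact set both the bilinear form and the
  -- Gaussian power are exponentially small.
  set S : Set ℝ := {θ | δ ≤ |θ| ∧ |θ| ≤ Real.pi} with hS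
  have hScomp : IsCompact S := by
    refine Metric.isCompact_of_isClosed_isBounded ?_ ?_
    · exact (isClosed_le continuous_const continuous_abs).inter
        (isClosed_le continuous_abs continuous_const)
    · refine (Metric.isBounded_closedBall (x := (0 : ℝ)) (r := Real.pi)).subset fun θ hθ => ?_
      simpa using hθ.2
  have hTc : Continuous fun θ : ℝ => R.twist (θ * Complex.I) := by
    unfold LinRep.twist
    fun_prop
  obtain ⟨C, σ, hσ0, hσ1, hC, hfar⟩ := exists_bilin_pow_bound_of_isCompact hScomp hTc
    (fun θ hθ => hR.spectralRadius_twist_lt_one (exp_mul_I_ne_one (by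
      rintro rfl
      have := hθ.1
      rw [abs_zero] at this
      linarith) hθ.2)) ξ η
  set τ : ℝ := Real.exp (-(γ * δ ^ 2 / 2)) with hτ
  have hτ0 : 0 < τ := Real.exp_pos _
  have hτ1 : τ < 1 := by
    rw [hτ, Real.exp_lt_one_iff, neg_lt_zero]
    positivity
  refine ⟨K + C + ‖c‖, max ρ (max σ τ), by positivity, lt_max_of_lt_left hρ0,
    max_lt hρ1 (max_lt hσ1 hτ1), fun n hn θ hθ => ?_⟩
  set b := Real.exp (-(γ / 8) * n * θ ^ 2) with hb
  have hb0 : 0 < b := Real.exp_pos _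
  set ω := max ρ (max σ τ) with hω
  have hω0 : 0 < ω := lt_max_of_lt_left hρ0
  rcases lt_or_ge |θ| δ with h | h
  · refine (hnear (by simpa using h) n hn).trans ?_
    gcongr
    · linarith [norm_nonneg c]
    · linarith [norm_nonneg c]
    · exact le_max_left _ _
  · have h1 := hfar θ ⟨h, hθ⟩ n
    have h2 : ‖c * Complex.exp (β * θ * Complex.I - γ * θ ^ 2 / 2) ^ n‖ ≤ ‖c‖ * τ ^ n := by
      rw [norm_mul, norm_pow]
      gcongr
      rw [Complex.norm_exp, hτ]
      apply Real.exp_le_exp.mpr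
      have h3 : δ ^ 2 ≤ θ ^ 2 := by
        rw [← sq_abs θ]
        gcongr
      simp [← Complex.ofReal_pow]
      nlinarith
    calc _ ≤ C * σ ^ n + ‖c‖ * τ ^ n := (norm_sub_le _ _).trans (add_le_add h1 h2)
      _ ≤ C * ω ^ n + ‖c‖ * ω ^ n := by
        gcongr
        · exact (le_max_left _ _).trans (le_max_right _ _)
        · exact (le_max_right _ _).trans (le_max_right _ _)
      _ = 0 + (C + ‖c‖) * ω ^ n := by ring
      _ ≤ _ := by
        gcongr
        · positivity
        · linarith

end LinRep.IsStochastic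

/-! ### Existence of the Perron branch. -/

open scoped ContDiff in
/-- The implicit function theorem for an analytic equation in one complex unknown. -/
theorem exists_analytic_implicit {F : ℂ × ℂ → ℂ} {z₀ x₀ d : ℂ} (hF : ContDiffAt ℂ ω F (z₀, x₀))
    (hd : HasDerivAt (fun x => F (z₀, x)) d x₀) (hd0 : d ≠ 0) :
    ∃ u : ℂ → ℂ, AnalyticAt ℂ u z₀ ∧ u z₀ = x₀ ∧ ∀ᶠ z in 𝓝 z₀, F (z, u z) = F (z₀, x₀) := by
  have hω : (ω : WithTop ℕ∞) ≠ 0 := by simp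
  have hfd : HasFDerivAt F (fderiv ℂ F (z₀, x₀)) (z₀, x₀) :=
    (hF.differentiableAt hω).hasFDerivAt
  have h1 : HasFDerivAt (fun x => F (z₀, x))
      (fderiv ℂ F (z₀, x₀) ∘L ContinuousLinearMap.inr ℂ ℂ ℂ) x₀ :=
    hfd.comp x₀ (hasFDerivAt_prodMk_right z₀ x₀)
  have h2 := h1.unique hd.hasFDerivAt
  have hinv : (fderiv ℂ F (z₀, x₀) ∘L ContinuousLinearMap.inr ℂ ℂ ℂ).IsInvertible := by
    rw [h2]
    refine ⟨ContinuousLinearEquiv.unitsEquivAut ℂ (Units.mk0 d hd0), ?_⟩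
    ext
    simp
  exact ⟨hF.implicitFunction hω hinv, (hF.contDiffAt_implicitFunction hω hinv).analyticAt,
    hF.implicitFunction_apply_self hω hinv, hF.eventually_apply_implicitFunction hω hinv⟩

open scoped ContDiff in
theorem contDiff_det {ι E : Type*} [Fintype ι] [DecidableEq ι] [NormedAddCommGroup E]
    [NormedSpace ℂ E] {T : E → Matrix ι ι ℂ} {n : ℕ∞ω} (hT : ∀ i j, ContDiff ℂ n fun x => T x i j) :
    ContDiff ℂ n fun x => (T x).det := by
  simp only [Matrix.det_apply']
  exact ContDiff.sum fun σ _ => contDiff_const.mul (contDiff_prod fun i _ => hT _ _)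

namespace LinRep.IsStochastic

variable {ι : Type} [Fintype ι] [DecidableEq ι] {R : LinRep ι} {p : ι → ℝ}

/-- The characteristic determinant of a stochastic matrix, with the factor vanishing at `1`. -/
theorem det_smul_one_sub (hR : R.IsStochastic p) {x : ℂ} (hx : x ≠ 0) :
    (x • (1 : Matrix ι ι ℂ) - R.twist 0).det =
      (x • (1 : Matrix ι ι ℂ) - R.twist 0 + rankOne p).det * (1 - x⁻¹) := by
  have h1 : R.twist 0 * rankOne p = rankOne p := by
    rw [twist_zero, rankOne, Matrix.mul_vecMulVec, hR.cast_mulVec_one]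
  have h2 : rankOne p * rankOne p = rankOne p := by
    rw [rankOne, Matrix.vecMulVec_mul_vecMulVec, hR.cast_dotProduct_one, one_smul]
  have h3 : x • (1 : Matrix ι ι ℂ) - R.twist 0 =
      (x • (1 : Matrix ι ι ℂ) - R.twist 0 + rankOne p) * (1 - x⁻¹ • rankOne p) := by
    rw [mul_sub, mul_one, mul_smul_comm, add_mul, sub_mul, h1, h2, smul_mul_assoc, one_mul,
      sub_add_cancel, smul_smul, inv_mul_cancel₀ hx, one_smul, add_sub_cancel_right]
  have h4 : (1 - x⁻¹ • rankOne p).det = 1 - x⁻¹ := by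
    have := Matrix.det_one_add_replicateCol_mul_replicateRow (ι := Unit)
      (fun _ : ι => -x⁻¹) (fun i => (p i : ℂ))
    have e : (1 : Matrix ι ι ℂ) - x⁻¹ • rankOne p =
        1 + replicateCol Unit (fun _ : ι => -x⁻¹) * replicateRow Unit (fun i => (p i : ℂ)) := by
      ext i j
      simp [rankOne, Matrix.mul_apply, sub_eq_add_neg]
    rw [e, this]
    have h5 : (fun i => (p i : ℂ)) ⬝ᵥ (fun _ : ι => -x⁻¹) = -x⁻¹ * ((fun i => (p i : ℂ)) ⬝ᵥ 1) := by
      simp [dotProduct, Finset.mul_sum, mul_comm]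
    rw [h5, hR.cast_dotProduct_one]
    ring
  conv_lhs => rw [h3, Matrix.det_mul, h4]

/-- The Perron branch exists. -/
theorem exists_branch (hR : R.IsStochastic p) :
    ∃ u : ℂ → ℂ, AnalyticAt ℂ u 0 ∧ u 0 = 1 ∧
      ∀ᶠ z in 𝓝 (0 : ℂ), (u z • (1 : Matrix ι ι ℂ) - R.twist z).det = 0 := by
  have hF : ContDiff ℂ ⊤ fun q : ℂ × ℂ => (q.2 • (1 : Matrix ι ι ℂ) - R.twist q.1).det := by
    refine contDiff_det fun i j => ?_
    simp only [Matrix.sub_apply, Matrix.smul_apply, twist_apply, smul_eq_mul]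
    fun_prop
  have hG : ContDiff ℂ 1 fun x : ℂ => (x • (1 : Matrix ι ι ℂ) - R.twist 0 + rankOne p).det := by
    refine contDiff_det fun i j => ?_
    simp only [Matrix.add_apply, Matrix.sub_apply, Matrix.smul_apply, smul_eq_mul]
    fun_prop
  have hd0 : ((1 : ℂ) • (1 : Matrix ι ι ℂ) - R.twist 0 + rankOne p).det ≠ 0 := by
    have := hR.isUnit_one_sub
    rwa [Matrix.isUnit_iff_isUnit_det, isUnit_iff_ne_zero, ← one_smul ℂ (1 : Matrix ι ι ℂ)] at this
  -- The factorisation of the characteristic determinant shows that 1 is a simple root, with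
  -- derivative the determinant of the invertible matrix `I - M + 1 p'`.
  have hd : HasDerivAt (fun x : ℂ => (x • (1 : Matrix ι ι ℂ) - R.twist 0).det)
      (((1 : ℂ) • (1 : Matrix ι ι ℂ) - R.twist 0 + rankOne p).det) 1 := by
    have h1 := ((hG.differentiable one_ne_zero) 1).hasDerivAt.mul
      ((hasDerivAt_inv (one_ne_zero (α := ℂ))).const_sub 1)
    have h2 : (fun x : ℂ => (x • (1 : Matrix ι ι ℂ) - R.twist 0).det) =ᶠ[𝓝 1] fun x =>
        (x • (1 : Matrix ι ι ℂ) - R.twist 0 + rankOne p).det * (1 - x⁻¹) := by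
      filter_upwards [isOpen_ne.mem_nhds (one_ne_zero (α := ℂ))] with x hx
      exact hR.det_smul_one_sub hx
    refine (h1.congr_of_eventuallyEq h2).congr_deriv ?_
    simp
  obtain ⟨u, hu, hu0, hev⟩ := exists_analytic_implicit hF.contDiffAt hd hd0
  refine ⟨u, hu, hu0, ?_⟩
  have hz : ((1 : ℂ) • (1 : Matrix ι ι ℂ) - R.twist 0).det = 0 := by
    rw [hR.det_smul_one_sub one_ne_zero]
    simp
  filter_upwards [hev] with z h
  exact h.trans hz

end LinRep.IsStochastic

/-! ### Fourier inversion and the local limit theorem with rate. -/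

section LocalLimit

open MeasureTheory

theorem integral_abs_mul_exp_neg_mul_sq {s : ℝ} (hs : 0 < s) :
    ∫ θ : ℝ, |θ| * Real.exp (-s * θ ^ 2) = 1 / s := by
  have h1 : ∫ θ : ℝ, |θ| * Real.exp (-s * θ ^ 2) =
      2 * ∫ θ in Set.Ioi (0 : ℝ), θ * Real.exp (-s * θ ^ 2) := by
    rw [← integral_comp_abs (f := fun θ => θ * Real.exp (-s * θ ^ 2))]
    simp only [sq_abs]
  have h2 : ((∫ θ in Set.Ioi (0 : ℝ), θ * Real.exp (-s * θ ^ 2) : ℝ) : ℂ) = (2 * (s : ℂ))⁻¹ := by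
    rw [← integral_mul_cexp_neg_mul_sq (b := s) (by simpa using hs), ← integral_complex_ofReal]
    push_cast
    rfl
  have h3 : ∫ θ in Set.Ioi (0 : ℝ), θ * Real.exp (-s * θ ^ 2) = (2 * s)⁻¹ := by
    exact_mod_cast h2
  rw [h1, h3]
  field_simp

theorem integrable_abs_mul_exp_neg_mul_sq {s : ℝ} (hs : 0 < s) :
    Integrable fun θ : ℝ => |θ| * Real.exp (-s * θ ^ 2) := by
  refine (integrable_mul_exp_neg_mul_sq hs).abs.congr (Eventually.of_forall fun θ => ?_)
  simp [abs_mul]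

theorem gaussian_factor_eq (β γ : ℝ) (n k : ℕ) (θ : ℝ) :
    Complex.exp (β * θ * Complex.I - γ * θ ^ 2 / 2) ^ n * Complex.exp (-(k * θ * Complex.I)) =
      Complex.exp (Complex.I * ((n * β - k : ℝ) : ℂ) * θ) *
        Complex.exp (-((n * γ / 2 : ℝ) : ℂ) * θ ^ 2) := by
  rw [← Complex.exp_nat_mul, ← Complex.exp_add, ← Complex.exp_add]
  congr 1
  push_cast
  ring

theorem integral_gaussian_factor {β γ : ℝ} (hγ : 0 < γ) {n : ℕ} (hn : 1 ≤ n) (k : ℕ) :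
    ∫ θ : ℝ, Complex.exp (β * θ * Complex.I - γ * θ ^ 2 / 2) ^ n *
      Complex.exp (-(k * θ * Complex.I)) =
      ((Real.sqrt (2 * Real.pi / (γ * n)) *
        Real.exp (-(((k : ℝ) - β * n) ^ 2 / (2 * γ * n))) : ℝ) : ℂ) := by
  have hn0 : (0 : ℝ) < n := by exact_mod_cast hn
  simp only [gaussian_factor_eq]
  rw [fourierIntegral_gaussian (b := ((n * γ / 2 : ℝ) : ℂ))
    (by rw [Complex.ofReal_re]; positivity), Complex.ofReal_mul, Real.sqrt_eq_rpow,
    Complex.ofReal_cpow (by positivity)]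
  congr 1
  · congr 1
    · push_cast
      field_simp
    · simp
  · rw [Complex.ofReal_exp]
    congr 1
    push_cast
    have h1 : (n : ℂ) ≠ 0 := by exact_mod_cast hn0.ne'
    have h2 : (γ : ℂ) ≠ 0 := by exact_mod_cast hγ.ne'
    field_simp
    ring

theorem integrable_gaussian_factor {β γ : ℝ} (hγ : 0 < γ) {n : ℕ} (hn : 1 ≤ n) (k : ℕ) :
    Integrable fun θ : ℝ => Complex.exp (β * θ * Complex.I - γ * θ ^ 2 / 2) ^ n *
      Complex.exp (-(k * θ * Complex.I)) := by
  have hn0 : (0 : ℝ) < n := by exact_mod_cast hn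
  simp only [gaussian_factor_eq]
  have := integrable_cexp_quadratic (b := ((n * γ / 2 : ℝ) : ℂ))
    (by rw [Complex.ofReal_re]; positivity) (Complex.I * ((n * β - k : ℝ) : ℂ)) 0
  refine this.congr (Eventually.of_forall fun θ => ?_)
  simp only
  rw [← Complex.exp_add]
  congr 1
  ring

theorem norm_exp_neg_mul_I (k : ℕ) (θ : ℝ) : ‖Complex.exp (-(k * θ * Complex.I))‖ = 1 := by
  rw [Complex.norm_exp]
  simp

theorem norm_gaussian_factor (β γ : ℝ) (n : ℕ) (θ : ℝ) :
    ‖Complex.exp (β * θ * Complex.I - γ * θ ^ 2 / 2) ^ n‖ = Real.exp (-(γ / 2 * n) * θ ^ 2) := by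
  rw [norm_pow, Complex.norm_exp, ← Real.exp_nat_mul]
  congr 1
  simp [← Complex.ofReal_pow]
  ring

/-- **Local limit theorem** with rate, from a Gaussian estimate of the characteristic functions. -/
theorem exists_local_limit_bound {a : ℕ → ℕ → ℝ} {P : ℕ → ℝ → ℂ} {β γ b K ρ c : ℝ}
    (hP : ∀ n, Continuous (P n))
    (ha : ∀ n k, ((2 * Real.pi * a n k : ℝ) : ℂ) =
      ∫ θ in (-Real.pi)..Real.pi, P n θ * Complex.exp (-(k * θ * Complex.I)))
    (hγ : 0 < γ) (hb : 0 < b) (hK : 0 ≤ K) (hρ0 : 0 < ρ) (hρ1 : ρ < 1)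
    (hbd : ∀ n : ℕ, 1 ≤ n → ∀ θ : ℝ, |θ| ≤ Real.pi →
      ‖P n θ - c * Complex.exp (β * θ * Complex.I - γ * θ ^ 2 / 2) ^ n‖ ≤
        K * (|θ| * Real.exp (-b * n * θ ^ 2)) + K * ρ ^ n) :
    ∃ C : ℝ, 0 ≤ C ∧ ∀ n : ℕ, 1 ≤ n → ∀ k : ℕ,
      |Real.sqrt n * a n k - c * (Real.exp (-(((k : ℝ) - β * n) ^ 2 / (2 * γ * n)))
        / Real.sqrt (2 * Real.pi * γ))| ≤ C / Real.sqrt n := by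
  have hπ := Real.pi_pos
  obtain ⟨D, hD⟩ := (tendsto_self_mul_const_pow_of_lt_one hρ0.le hρ1).bddAbove_range
  have hD' : ∀ n : ℕ, n * ρ ^ n ≤ D := fun n => hD ⟨n, rfl⟩
  have hD0 : 0 ≤ D := by simpa using hD' 0
  -- The terms are `n` times the bounds for the central error, the Gaussian tail outside `[-π, π]`,
  -- and the exponential error over an interval of length `2π`; `D` bounds `n ρ^n`.
  refine ⟨(K / b + |c| * (2 / γ) + 2 * Real.pi * K * D) / (2 * Real.pi), by positivity,
    fun n hn k => ?_⟩
  have hn0 : (0 : ℝ) < n := by exact_mod_cast hn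
  set S : Set ℝ := Set.Ioc (-Real.pi) Real.pi with hS
  set e : ℝ → ℂ := fun θ => Complex.exp (-(k * θ * Complex.I)) with he
  set g : ℝ → ℂ := fun θ => Complex.exp (β * θ * Complex.I - γ * θ ^ 2 / 2) ^ n with hg
  have hec : Continuous e := by
    simp only [he]
    fun_prop
  have hPi : Integrable (S.indicator fun θ => P n θ * e θ) := by
    rw [integrable_indicator_iff measurableSet_Ioc]
    exact (((hP n).mul hec).integrableOn_Icc).mono_set Set.Ioc_subset_Icc_self
  have hGi : Integrable fun θ => (c : ℂ) * (g θ * e θ) :=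
    (integrable_gaussian_factor hγ hn k).const_mul _
  have hint : ∫ θ, ((S.indicator fun θ => P n θ * e θ) θ - (c : ℂ) * (g θ * e θ)) =
      ((2 * Real.pi * a n k - c * (Real.sqrt (2 * Real.pi / (γ * n)) *
        Real.exp (-(((k : ℝ) - β * n) ^ 2 / (2 * γ * n)))) : ℝ) : ℂ) := by
    rw [integral_sub hPi hGi, integral_const_mul, integral_gaussian_factor hγ hn,
      integral_indicator measurableSet_Ioc, Complex.ofReal_sub, ha,
      intervalIntegral.integral_of_le (by linarith), Complex.ofReal_mul c]
  have hB1 := (integrable_abs_mul_exp_neg_mul_sq (mul_pos hb hn0)).const_mul K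
  have hB2 := (integrable_abs_mul_exp_neg_mul_sq
    (mul_pos (half_pos hγ) hn0)).const_mul |c|
  have hB12 : Integrable fun θ : ℝ => K * (|θ| * Real.exp (-(b * n) * θ ^ 2)) +
      |c| * (|θ| * Real.exp (-(γ / 2 * n) * θ ^ 2)) := hB1.add hB2
  have hB3 : Integrable (S.indicator fun _ : ℝ => K * ρ ^ n) := by
    rw [integrable_indicator_iff measurableSet_Ioc]
    exact integrableOn_const (by simp)
  have hnorm : ‖∫ θ, ((S.indicator fun θ => P n θ * e θ) θ - (c : ℂ) * (g θ * e θ))‖ ≤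
      ∫ θ : ℝ, (K * (|θ| * Real.exp (-(b * n) * θ ^ 2)) +
        |c| * (|θ| * Real.exp (-(γ / 2 * n) * θ ^ 2)) +
          S.indicator (fun _ : ℝ => K * ρ ^ n) θ) := by
    refine norm_integral_le_of_norm_le (hB12.add hB3) (Eventually.of_forall fun θ => ?_)
    have h2 : 0 ≤ |c| * (|θ| * Real.exp (-(γ / 2 * n) * θ ^ 2)) := by positivity
    have h1 : 0 ≤ K * (|θ| * Real.exp (-(b * n) * θ ^ 2)) := by positivity
    by_cases hθ : θ ∈ S
    · rw [Set.indicator_of_mem hθ, Set.indicator_of_mem hθ]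
      have h3 : P n θ * e θ - c * (g θ * e θ) = (P n θ - c * g θ) * e θ := by ring
      rw [h3, norm_mul, norm_exp_neg_mul_I, mul_one]
      have h4 := hbd n hn θ (abs_le.mpr ⟨hθ.1.le, hθ.2⟩)
      rw [neg_mul b] at h4
      linarith
    · rw [Set.indicator_of_notMem hθ, Set.indicator_of_notMem hθ, zero_sub, norm_neg, norm_mul,
        norm_mul, norm_exp_neg_mul_I, mul_one, norm_gaussian_factor, Complex.norm_real,
        Real.norm_eq_abs]
      -- Outside the period `|θ| ≥ 1`, so the tail may be multiplied by `|θ|` and integrated over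
      -- the whole line at cost `O(1/n)`.
      have h3 : 1 ≤ |θ| := by
        by_contra hlt
        rw [not_le, abs_lt] at hlt
        have := Real.pi_gt_three
        exact hθ ⟨by linarith, by linarith⟩
      have h4 : |c| * Real.exp (-(γ / 2 * n) * θ ^ 2) ≤
          |c| * (|θ| * Real.exp (-(γ / 2 * n) * θ ^ 2)) := by
        gcongr
        exact le_mul_of_one_le_left (Real.exp_pos _).le h3
      linarith
  rw [hint, Complex.norm_real, Real.norm_eq_abs, integral_add hB12 hB3,
    integral_add hB1 hB2, integral_const_mul, integral_const_mul,
    integral_abs_mul_exp_neg_mul_sq (mul_pos hb hn0),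
    integral_abs_mul_exp_neg_mul_sq (mul_pos (half_pos hγ) hn0),
    integral_indicator measurableSet_Ioc, setIntegral_const, Real.volume_real_Ioc_of_le (by linarith),
    smul_eq_mul] at hnorm
  have hsn : 0 < Real.sqrt n := Real.sqrt_pos.mpr hn0
  have hsq : Real.sqrt n * Real.sqrt n = n := Real.mul_self_sqrt hn0.le
  have hfac : Real.sqrt n * Real.sqrt (2 * Real.pi / (γ * n)) / (2 * Real.pi) =
      1 / Real.sqrt (2 * Real.pi * γ) := by
    have h1 : Real.sqrt n * Real.sqrt (2 * Real.pi / (γ * n)) = Real.sqrt (2 * Real.pi / γ) := by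
      rw [← Real.sqrt_mul hn0.le]
      congr 1
      field_simp
    have h2 : Real.sqrt (2 * Real.pi / γ) * Real.sqrt (2 * Real.pi * γ) = 2 * Real.pi := by
      have h3 : 2 * Real.pi / γ * (2 * Real.pi * γ) = 2 * Real.pi * (2 * Real.pi) := by field_simp
      rw [← Real.sqrt_mul (by positivity), h3, Real.sqrt_mul_self (by positivity)]
    rw [h1, div_eq_div_iff (by positivity) (by positivity), h2, one_mul]
  have hid : Real.sqrt n * a n k - c * (Real.exp (-(((k : ℝ) - β * n) ^ 2 / (2 * γ * n)))
        / Real.sqrt (2 * Real.pi * γ)) = Real.sqrt n / (2 * Real.pi) *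
      (2 * Real.pi * a n k - c * (Real.sqrt (2 * Real.pi / (γ * n)) *
        Real.exp (-(((k : ℝ) - β * n) ^ 2 / (2 * γ * n))))) := by
    rw [div_eq_mul_one_div (Real.exp _), ← hfac]
    field_simp
  rw [hid, abs_mul, abs_of_pos (by positivity : 0 < Real.sqrt n / (2 * Real.pi))]
  have hρn : ρ ^ n ≤ D / n := by
    rw [le_div_iff₀ hn0, mul_comm]
    exact hD' n
  calc _ ≤ Real.sqrt n / (2 * Real.pi) * (K * (1 / (b * n)) + |c| * (1 / (γ / 2 * n)) +
        (Real.pi - -Real.pi) * (K * ρ ^ n)) := by gcongr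
    _ ≤ Real.sqrt n / (2 * Real.pi) * (K * (1 / (b * n)) + |c| * (1 / (γ / 2 * n)) +
        (Real.pi - -Real.pi) * (K * (D / n))) := by
      have : 0 ≤ Real.pi - -Real.pi := by linarith
      gcongr
    _ = (K / b + |c| * (2 / γ) + 2 * Real.pi * K * D) / (2 * Real.pi) *
        (Real.sqrt n / n) := by
      field_simp
      ring
    _ = _ := by
      have : Real.sqrt n / n = 1 / Real.sqrt n := by
        rw [div_eq_div_iff hn0.ne' hsn.ne', hsq, one_mul]
      rw [this]
      ring

end LocalLimit

/-! ### Word weights as coefficients of the matrix powers. -/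

section Words

theorem word_cons {n : ℕ} (x : Letter) (w : Fin n → Letter) :
    word (Fin.cons x w : Fin (n + 1) → Letter) = FreeMonoid.of x * word w := by
  simp only [word, List.ofFn_succ, Fin.cons_zero, Fin.cons_succ]
  rfl

theorem countA_cons_a {n : ℕ} (w : Fin n → Letter) :
    countA (Fin.cons Letter.a w : Fin (n + 1) → Letter) = countA w + 1 := by
  simp [countA, List.ofFn_succ]

theorem countA_cons_b {n : ℕ} (w : Fin n → Letter) :
    countA (Fin.cons Letter.b w : Fin (n + 1) → Letter) = countA w := by
  simp [countA, List.ofFn_succ]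

theorem sum_words_succ {E : Type*} [AddCommMonoid E] {n : ℕ} (f : (Fin (n + 1) → Letter) → E) :
    ∑ w, f w = ∑ w : Fin n → Letter, f (Fin.cons Letter.a w) +
      ∑ w : Fin n → Letter, f (Fin.cons Letter.b w) := by
  rw [← (Fin.consEquiv fun _ : Fin (n + 1) => Letter).sum_comp, Fintype.sum_prod_type]
  exact Finset.sum_pair (by decide)

namespace LinRep

variable {ι : Type} [Fintype ι] [DecidableEq ι] (R : LinRep ι)

theorem morphism_of (x : Letter) : R.morphism (FreeMonoid.of x) = R.mat x := by
  simp [morphism]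

/-- The total weight of the words of length `n` with `k` occurrences of `a`. -/
noncomputable def weight (n k : ℕ) : ℝ :=
  ∑ w : Fin n → Letter with countA w = k, R.series (word w)

/-- The total weight of the words of length `n`. -/
noncomputable def totalWeight (n : ℕ) : ℝ := ∑ w : Fin n → Letter, R.series (word w)

theorem sum_exp_smul_morphism (z : ℂ) (n : ℕ) :
    ∑ w : Fin n → Letter, Complex.exp z ^ countA w •
      (R.morphism (word w)).map (algebraMap ℝ ℂ) = R.twist z ^ n := by
  induction n with
  | zero =>
    rw [Fintype.sum_unique]
    simp [countA, word]
  | succ n ih =>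
    rw [sum_words_succ, pow_succ', ← ih, twist, add_mul, Finset.mul_sum, Finset.mul_sum]
    congr 1
    · refine Finset.sum_congr rfl fun w _ => ?_
      rw [word_cons, countA_cons_a, map_mul, morphism_of, Matrix.map_mul, smul_mul_smul_comm,
        pow_succ']
      rfl
    · refine Finset.sum_congr rfl fun w _ => ?_
      rw [word_cons, countA_cons_b, map_mul, morphism_of, Matrix.map_mul, mul_smul_comm]
      rfl

theorem ofReal_series (w : FreeMonoid Letter) :
    (R.series w : ℂ) = (fun i => (R.ξ i : ℂ)) ⬝ᵥ
      ((R.morphism w).map (algebraMap ℝ ℂ) *ᵥ fun i => (R.η i : ℂ)) := by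
  rw [map_mulVec_ofReal]
  simp [series, dotProduct]

/-- The generating function of the number of `a` as a bilinear form. -/
theorem bilin_twist_pow (z : ℂ) (n : ℕ) :
    (fun i => (R.ξ i : ℂ)) ⬝ᵥ (R.twist z ^ n *ᵥ fun i => (R.η i : ℂ)) =
      ∑ w : Fin n → Letter, Complex.exp z ^ countA w * (R.series (word w) : ℂ) := by
  rw [← sum_exp_smul_morphism, Matrix.sum_mulVec, dotProduct_sum]
  refine Finset.sum_congr rfl fun w _ => ?_
  rw [Matrix.smul_mulVec, dotProduct_smul, ofReal_series, smul_eq_mul]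

theorem bilin_twist_zero_pow (n : ℕ) :
    (fun i => (R.ξ i : ℂ)) ⬝ᵥ (R.twist 0 ^ n *ᵥ fun i => (R.η i : ℂ)) = (R.totalWeight n : ℂ) := by
  rw [bilin_twist_pow, totalWeight]
  simp

theorem morphism_nonneg (w : FreeMonoid Letter) (i j : ι) : 0 ≤ R.morphism w i j := by
  induction w using FreeMonoid.inductionOn' generalizing i j with
  | one =>
    rw [map_one, Matrix.one_apply]
    split_ifs <;> norm_num
  | of_mul x w ih =>
    rw [map_mul, morphism_of, Matrix.mul_apply]
    refine Finset.sum_nonneg fun k _ => mul_nonneg ?_ (ih k j)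
    cases x
    · exact R.A_nonneg i k
    · exact R.B_nonneg i k

theorem series_nonneg (w : FreeMonoid Letter) : 0 ≤ R.series w :=
  Finset.sum_nonneg fun i _ => mul_nonneg (R.ξ_nonneg i)
    (Finset.sum_nonneg fun j _ => mul_nonneg (R.morphism_nonneg w i j) (R.η_nonneg j))

theorem weight_nonneg (n k : ℕ) : 0 ≤ R.weight n k :=
  Finset.sum_nonneg fun _ _ => R.series_nonneg _

theorem weight_le_totalWeight (n k : ℕ) : R.weight n k ≤ R.totalWeight n :=
  Finset.sum_le_sum_of_subset_of_nonneg (Finset.filter_subset _ _)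
    fun _ _ _ => R.series_nonneg _

theorem prY_eq (n k : ℕ) : R.prY n k = R.weight n k / R.totalWeight n := by
  simp only [prY, wordProb, weight, totalWeight, Finset.sum_div]

theorem integral_exp_pow_mul_exp (m k : ℕ) :
    ∫ θ in (-Real.pi)..Real.pi, Complex.exp (θ * Complex.I) ^ m *
      Complex.exp (-(k * θ * Complex.I)) = if m = k then ((2 * Real.pi : ℝ) : ℂ) else 0 := by
  have h : ∀ θ : ℝ, Complex.exp (θ * Complex.I) ^ m * Complex.exp (-(k * θ * Complex.I)) =
      Complex.exp (((m : ℂ) - k) * Complex.I * θ) := fun θ => by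
    rw [← Complex.exp_nat_mul, ← Complex.exp_add]
    congr 1
    ring
  simp only [h]
  split_ifs with hmk
  · subst hmk
    simp
    ring
  · have h0 : ((m : ℂ) - k) * Complex.I ≠ 0 :=
      mul_ne_zero (sub_ne_zero.mpr (by exact_mod_cast hmk)) Complex.I_ne_zero
    rw [integral_exp_mul_complex h0, div_eq_zero_iff, sub_eq_zero]
    left
    rw [Complex.exp_eq_exp_iff_exists_int]
    refine ⟨(m : ℤ) - k, ?_⟩
    push_cast
    ring

/-- Fourier inversion for the number of `a`. -/
theorem two_pi_mul_weight (n k : ℕ) :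
    ((2 * Real.pi * R.weight n k : ℝ) : ℂ) = ∫ θ in (-Real.pi)..Real.pi,
      (fun i => (R.ξ i : ℂ)) ⬝ᵥ (R.twist (θ * Complex.I) ^ n *ᵥ fun i => (R.η i : ℂ)) *
        Complex.exp (-(k * θ * Complex.I)) := by
  have h : ∀ θ : ℝ, (fun i => (R.ξ i : ℂ)) ⬝ᵥ
      (R.twist (θ * Complex.I) ^ n *ᵥ fun i => (R.η i : ℂ)) * Complex.exp (-(k * θ * Complex.I)) =
      ∑ w : Fin n → Letter, (R.series (word w) : ℂ) *
        (Complex.exp (θ * Complex.I) ^ countA w * Complex.exp (-(k * θ * Complex.I))) := fun θ => by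
    rw [bilin_twist_pow, Finset.sum_mul]
    exact Finset.sum_congr rfl fun w _ => by ring
  simp only [h]
  rw [intervalIntegral.integral_finsetSum fun w _ =>
    (Continuous.intervalIntegrable (by fun_prop) _ _)]
  simp only [intervalIntegral.integral_const_mul, integral_exp_pow_mul_exp, mul_ite, mul_zero]
  rw [← Finset.sum_filter, ← Finset.sum_mul, weight]
  push_cast
  ring

end LinRep

/-! ### Additivity of the weights over the two components. -/

section Sum

variable {ι₁ ι₂ : Type} [Fintype ι₁] [DecidableEq ι₁] [Fintype ι₂] [DecidableEq ι₂]
  (R₁ : LinRep ι₁) (R₂ : LinRep ι₂)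

theorem morphism_sum (w : FreeMonoid Letter) : (R₁.sum R₂).morphism w =
    Matrix.fromBlocks (R₁.morphism w) 0 0 (R₂.morphism w) := by
  induction w using FreeMonoid.inductionOn' with
  | one => simp [Matrix.fromBlocks_one]
  | of_mul x w ih =>
    have h : (R₁.sum R₂).mat x = Matrix.fromBlocks (R₁.mat x) 0 0 (R₂.mat x) := by
      cases x <;> rfl
    rw [map_mul, map_mul, map_mul, ih, LinRep.morphism_of, LinRep.morphism_of, LinRep.morphism_of,
      h, Matrix.fromBlocks_multiply]
    simp

theorem series_sum (w : FreeMonoid Letter) :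
    (R₁.sum R₂).series w = R₁.series w + R₂.series w := by
  rw [LinRep.series, morphism_sum]
  simp only [LinRep.series, LinRep.sum]
  rw [Matrix.fromBlocks_mulVec]
  simp [Function.comp_def]

theorem weight_sum (n k : ℕ) : (R₁.sum R₂).weight n k = R₁.weight n k + R₂.weight n k := by
  simp only [LinRep.weight, series_sum, Finset.sum_add_distrib]

theorem totalWeight_sum (n : ℕ) :
    (R₁.sum R₂).totalWeight n = R₁.totalWeight n + R₂.totalWeight n := by
  simp only [LinRep.totalWeight, series_sum, Finset.sum_add_distrib]

end Sum

end Words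

/-! ### Reduction to the stochastic case by diagonal scaling. -/

section Conj

variable {ι : Type*}

/-- The matrix `r⁻¹ D⁻¹ T D` with `D = diag v`. -/
noncomputable def conjScale (r : ℝ) (v : ι → ℝ) (T : Matrix ι ι ℝ) : Matrix ι ι ℝ :=
  Matrix.of fun i j => r⁻¹ * (v i)⁻¹ * T i j * v j

theorem conjScale_apply (r : ℝ) (v : ι → ℝ) (T : Matrix ι ι ℝ) (i j : ι) :
    conjScale r v T i j = r⁻¹ * (v i)⁻¹ * T i j * v j := rfl

theorem conjScale_pos_iff {r : ℝ} {v : ι → ℝ} (hr : 0 < r) (hv : ∀ i, 0 < v i)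
    (T : Matrix ι ι ℝ) (i j : ι) : 0 < conjScale r v T i j ↔ 0 < T i j := by
  rw [conjScale_apply, mul_pos_iff_of_pos_right (hv j),
    mul_pos_iff_of_pos_left (mul_pos (inv_pos.mpr hr) (inv_pos.mpr (hv i)))]

theorem conjScale_add (r : ℝ) (v : ι → ℝ) (S T : Matrix ι ι ℝ) :
    conjScale r v (S + T) = conjScale r v S + conjScale r v T := by
  ext i j
  simp only [conjScale_apply, Matrix.add_apply]
  ring

theorem conjScale_one_one [DecidableEq ι] {v : ι → ℝ} (hv : ∀ i, 0 < v i) :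
    conjScale 1 v (1 : Matrix ι ι ℝ) = 1 := by
  ext i j
  rw [conjScale_apply]
  by_cases h : i = j
  · subst h
    have := (hv i).ne'
    simp [this]
  · simp [h]

variable [Fintype ι]

theorem conjScale_mul {r s : ℝ} {v : ι → ℝ} (hv : ∀ i, 0 < v i) (S T : Matrix ι ι ℝ) :
    conjScale (r * s) v (S * T) = conjScale r v S * conjScale s v T := by
  ext i j
  simp only [conjScale_apply, Matrix.mul_apply, Finset.mul_sum, Finset.sum_mul]
  refine Finset.sum_congr rfl fun k _ => ?_
  have := (hv k).ne'
  rw [mul_inv]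
  field_simp

theorem conjScale_pow [DecidableEq ι] {r : ℝ} {v : ι → ℝ} (hv : ∀ i, 0 < v i) (T : Matrix ι ι ℝ)
    (n : ℕ) : conjScale r v T ^ n = conjScale (r ^ n) v (T ^ n) := by
  induction n with
  | zero => rw [pow_zero, pow_zero, pow_zero, conjScale_one_one hv]
  | succ n ih => rw [pow_succ, ih, pow_succ, pow_succ, conjScale_mul hv]

end Conj

namespace LinRep

variable {ι : Type} (R : LinRep ι)

/-- The linear representation `(D ξ, r⁻¹ D⁻¹ A D, r⁻¹ D⁻¹ B D, D⁻¹ η)` with `D = diag v`. -/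
noncomputable def rescale {r : ℝ} {v : ι → ℝ} (hr : 0 < r) (hv : ∀ i, 0 < v i) : LinRep ι where
  ξ i := R.ξ i * v i
  A := conjScale r v R.A
  B := conjScale r v R.B
  η i := (v i)⁻¹ * R.η i
  ξ_nonneg i := mul_nonneg (R.ξ_nonneg i) (hv i).le
  A_nonneg i j := mul_nonneg (mul_nonneg (mul_nonneg (inv_nonneg.mpr hr.le)
    (inv_nonneg.mpr (hv i).le)) (R.A_nonneg i j)) (hv j).le
  B_nonneg i j := mul_nonneg (mul_nonneg (mul_nonneg (inv_nonneg.mpr hr.le)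
    (inv_nonneg.mpr (hv i).le)) (R.B_nonneg i j)) (hv j).le
  η_nonneg i := mul_nonneg (inv_nonneg.mpr (hv i).le) (R.η_nonneg i)

variable {r : ℝ} {v : ι → ℝ} (hr : 0 < r) (hv : ∀ i, 0 < v i)

theorem rescale_mat (x : Letter) : (R.rescale hr hv).mat x = conjScale r v (R.mat x) := by
  cases x <;> rfl

theorem rescale_M : (R.rescale hr hv).M = conjScale r v R.M := (conjScale_add r v R.A R.B).symm

theorem isLabelledPath_rescale {i k : ι} {w : List Letter} :
    (R.rescale hr hv).IsLabelledPath i w k ↔ R.IsLabelledPath i w k := by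
  constructor
  · intro h
    induction h with
    | nil i => exact .nil i
    | cons x h p ih =>
      rw [rescale_mat, conjScale_pos_iff hr hv] at h
      exact .cons x h ih
  · intro h
    induction h with
    | nil i => exact .nil i
    | cons x h p ih =>
      exact .cons x (by rwa [rescale_mat, conjScale_pos_iff hr hv]) ih

theorem isAperiodicPair_rescale (h : R.IsAperiodicPair) :
    (R.rescale hr hv).IsAperiodicPair := by
  simpa only [IsAperiodicPair, cycleDifferences, IsCycleLabel, isLabelledPath_rescale] using h

variable [Fintype ι] [DecidableEq ι]

theorem rescale_morphism (w : FreeMonoid Letter) :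
    (R.rescale hr hv).morphism w = conjScale (r ^ w.length) v (R.morphism w) := by
  induction w using FreeMonoid.inductionOn' with
  | one => simp [conjScale_one_one hv]
  | of_mul x w ih =>
    rw [map_mul, map_mul, ih, morphism_of, morphism_of, rescale_mat, ← conjScale_mul hv]
    simp [pow_add]

/-- The diagonal factors telescope along a word and cancel against `ξ` and `η`. What remains depends
only on the length, so probabilities at fixed `n` are unaffected. -/
theorem rescale_series (w : FreeMonoid Letter) :
    (R.rescale hr hv).series w = (r ^ w.length)⁻¹ * R.series w := by
  have hξ : ∀ i, (R.rescale hr hv).ξ i = R.ξ i * v i := fun _ => rfl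
  have hη : ∀ i, (R.rescale hr hv).η i = (v i)⁻¹ * R.η i := fun _ => rfl
  simp only [series, rescale_morphism, hξ, hη, Matrix.mulVec, dotProduct, conjScale_apply,
    Finset.mul_sum]
  refine Finset.sum_congr rfl fun i _ => Finset.sum_congr rfl fun j _ => ?_
  have h1 := (hv i).ne'
  have h2 := (hv j).ne'
  field_simp

theorem length_word {n : ℕ} (w : Fin n → Letter) : (word w).length = n := by
  simp [word, FreeMonoid.length]

theorem rescale_weight (n k : ℕ) : (R.rescale hr hv).weight n k = (r ^ n)⁻¹ * R.weight n k := by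
  simp only [weight, rescale_series, length_word, Finset.mul_sum]

theorem rescale_totalWeight (n : ℕ) :
    (R.rescale hr hv).totalWeight n = (r ^ n)⁻¹ * R.totalWeight n := by
  simp only [totalWeight, rescale_series, length_word, Finset.mul_sum]

/-- Diagonal similarity followed by division by `r`. It carries branches of the original equation to
branches `u / r` of the rescaled one, and back. -/
theorem det_rescale_eq_zero_iff (x z : ℂ) :
    ((x / r) • (1 : Matrix ι ι ℂ) - (R.rescale hr hv).twist z).det = 0 ↔
      (x • (1 : Matrix ι ι ℂ) - R.twist z).det = 0 := by
  have hrc : (r : ℂ) ≠ 0 := by exact_mod_cast hr.ne'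
  have hvc : ∀ i, (v i : ℂ) ≠ 0 := fun i => by exact_mod_cast (hv i).ne'
  have h : (x / r) • (1 : Matrix ι ι ℂ) - (R.rescale hr hv).twist z =
      (r : ℂ)⁻¹ • (diagonal (fun i => (v i : ℂ)⁻¹) * (x • (1 : Matrix ι ι ℂ) - R.twist z) *
        diagonal (fun i => (v i : ℂ))) := by
    ext i j
    simp only [Matrix.sub_apply, Matrix.smul_apply, smul_eq_mul, Matrix.mul_diagonal,
      Matrix.diagonal_mul, twist_apply, rescale, conjScale_apply, Complex.ofReal_mul,
      Complex.ofReal_inv]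
    by_cases hij : i = j
    · subst hij
      have := hvc i
      rw [Matrix.one_apply_eq]
      field_simp
    · rw [Matrix.one_apply_ne hij]
      ring
  rw [h, Matrix.det_smul, Matrix.det_mul, Matrix.det_mul, Matrix.det_diagonal, Matrix.det_diagonal]
  have h1 : (∏ i, (v i : ℂ)) ≠ 0 := Finset.prod_ne_zero_iff.mpr fun i _ => hvc i
  simp [h1, hrc]

/-- The rescaling by the Perron eigenvector is stochastic. -/
theorem exists_isStochastic_rescale [Nonempty ι] (hprim : R.M.IsPrimitive)
    (haper : R.IsAperiodicPair) :
    ∃ (hr : 0 < R.perronValue) (v : ι → ℝ) (hv : ∀ i, 0 < v i) (p : ι → ℝ),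
      (R.rescale hr hv).IsStochastic p := by
  obtain ⟨hr, v, hv, hMv⟩ := exists_pos_eigenvector hprim
  have hr' : 0 < R.perronValue := hr
  have hMv' : R.M *ᵥ v = R.perronValue • v := hMv
  obtain ⟨w, hw, hwM⟩ := exists_pos_left_eigenvector hprim hv hMv'
  set s : ℝ := w ⬝ᵥ v with hs
  have hs0 : 0 < s := Finset.sum_pos (fun i _ => mul_pos (hw i) (hv i)) Finset.univ_nonempty
  -- The stationary law is the normalised product of the left and right Perron vectors.
  refine ⟨hr', v, hv, fun i => s⁻¹ * (w i * v i), ?_, ?_, ?_, ?_, ?_, ?_⟩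
  · funext i
    have h1 : ∑ j, R.M i j * v j = R.perronValue * v i := congrFun hMv' i
    simp only [rescale_M, Matrix.mulVec, dotProduct, conjScale_apply, Pi.one_apply, mul_one,
      mul_assoc, ← Finset.mul_sum, h1]
    have := (hv i).ne'
    field_simp
  · funext j
    have h1 : ∑ i, w i * R.M i j = R.perronValue * w j := congrFun hwM j
    simp only [rescale_M, Matrix.vecMul, dotProduct, conjScale_apply]
    have h2 : ∀ i, s⁻¹ * (w i * v i) * (R.perronValue⁻¹ * (v i)⁻¹ * R.M i j * v j) =
        s⁻¹ * R.perronValue⁻¹ * v j * (w i * R.M i j) := fun i => by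
      have := (hv i).ne'
      field_simp
    simp only [h2, ← Finset.mul_sum, h1]
    field_simp
  · exact fun i => mul_pos (inv_pos.mpr hs0) (mul_pos (hw i) (hv i))
  · rw [← Finset.mul_sum]
    exact inv_mul_cancel₀ hs0.ne'
  · obtain ⟨hnn, k, hk, hpos⟩ := hprim
    refine ⟨fun i j => ?_, k, hk, fun i j => ?_⟩
    · exact add_nonneg ((R.rescale hr' hv).A_nonneg i j) ((R.rescale hr' hv).B_nonneg i j)
    · rw [rescale_M, conjScale_pow hv, conjScale_pos_iff (pow_pos hr' k) hv]
      exact hpos i j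
  · exact R.isAperiodicPair_rescale hr' hv haper

/-- The total weights grow at most exponentially at any rate above the Perron value. -/
theorem exists_totalWeight_bound [Nonempty ι] {r : ℝ} (h : R.perronValue < r) :
    ∃ C ρ : ℝ, 0 < ρ ∧ ρ < 1 ∧ 0 ≤ C ∧ ∀ n : ℕ, (r ^ n)⁻¹ * R.totalWeight n ≤ C * ρ ^ n := by
  have hr : 0 < r := ENNReal.toReal_nonneg.trans_lt h
  obtain ⟨C, ρ, h0, h1, hC, hev⟩ := exists_bilin_pow_bound
    (T := fun _ : ℝ => (r : ℂ)⁻¹ • R.M.map (algebraMap ℝ ℂ)) (x₀ := 0) continuousAt_const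
    (spectralRadius_inv_smul_lt_one h) (fun i => (R.ξ i : ℂ)) (fun i => (R.η i : ℂ))
  refine ⟨C, ρ, h0, h1, hC, fun n => ?_⟩
  have h2 := hev.self_of_nhds n
  rw [smul_pow, Matrix.smul_mulVec, dotProduct_smul, ← twist_zero, bilin_twist_zero_pow,
    smul_eq_mul, norm_mul, norm_pow, norm_inv, Complex.norm_real, Complex.norm_real,
    Real.norm_of_nonneg hr.le, Real.norm_eq_abs, inv_pow] at h2
  exact (mul_le_mul_of_nonneg_left (le_abs_self _) (by positivity)).trans h2

/-- Local limit theorem for the weights of a stochastic representation, and the limit of the total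
weights. -/
theorem IsStochastic.exists_weight_bound {R : LinRep ι} {p : ι → ℝ} (hR : R.IsStochastic p)
    {u : ℂ → ℂ} (hu : AnalyticAt ℂ u 0) (hu0 : u 0 = 1)
    (hdet : ∀ᶠ z in 𝓝 (0 : ℂ), (u z • (1 : Matrix ι ι ℂ) - R.twist z).det = 0)
    {β γ : ℝ} (hγ : 0 < γ) (hu1 : deriv u 0 = β) (hu2 : iteratedDeriv 2 u 0 = γ + (β : ℂ) ^ 2)
    (hξ : R.ξ ≠ 0) (hη : R.η ≠ 0) :
    ∃ c : ℝ, 0 < c ∧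
      (∃ C : ℝ, 0 ≤ C ∧ ∀ n : ℕ, 1 ≤ n → ∀ k : ℕ,
        |Real.sqrt n * R.weight n k - c * (Real.exp (-(((k : ℝ) - β * n) ^ 2 / (2 * γ * n)))
          / Real.sqrt (2 * Real.pi * γ))| ≤ C / Real.sqrt n) ∧
      ∃ K ρ : ℝ, 0 ≤ K ∧ 0 < ρ ∧ ρ < 1 ∧ ∀ n : ℕ, 1 ≤ n → |R.totalWeight n - c| ≤ K * ρ ^ n := by
  obtain ⟨K, ρ, hK, hρ0, hρ1, hbd⟩ := hR.exists_char_bound hu hu0 hdet hγ hu1 hu2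
    (fun i => (R.ξ i : ℂ)) (fun i => (R.η i : ℂ))
  set c : ℝ := (∑ i, R.ξ i) * ∑ i, p i * R.η i with hc
  have hcc : ((fun i => (R.ξ i : ℂ)) ⬝ᵥ 1) * ((fun i => (p i : ℂ)) ⬝ᵥ fun i => (R.η i : ℂ)) =
      (c : ℂ) := by
    simp [dotProduct, hc]
  have hc0 : 0 < c := by
    obtain ⟨i, hi⟩ := Function.ne_iff.mp hξ
    obtain ⟨j, hj⟩ := Function.ne_iff.mp hη
    exact mul_pos (Finset.sum_pos' (fun i _ => R.ξ_nonneg i)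
      ⟨i, Finset.mem_univ i, lt_of_le_of_ne (R.ξ_nonneg i) (Ne.symm hi)⟩)
      (Finset.sum_pos' (fun j _ => mul_nonneg (hR.pos j).le (R.η_nonneg j))
        ⟨j, Finset.mem_univ j, mul_pos (hR.pos j) (lt_of_le_of_ne (R.η_nonneg j) (Ne.symm hj))⟩)
  rw [hcc] at hbd
  refine ⟨c, hc0, ?_, K, ρ, hK, hρ0, hρ1, fun n hn => ?_⟩
  · refine exists_local_limit_bound (P := fun n θ => (fun i => (R.ξ i : ℂ)) ⬝ᵥ
      (R.twist (θ * Complex.I) ^ n *ᵥ fun i => (R.η i : ℂ))) (fun n => ?_)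
      R.two_pi_mul_weight hγ (by positivity : 0 < γ / 8) hK hρ0 hρ1 hbd
    simp only [bilin_twist_pow]
    fun_prop
  -- The total weight is the characteristic function at `θ = 0`, where the `|θ|` term vanishes and
  -- only the exponential error is left.
  · have h := hbd n hn 0 (by simpa using Real.pi_pos.le)
    simp only [Complex.ofReal_zero, zero_mul, bilin_twist_zero_pow] at h
    simp only [mul_zero, zero_mul, sub_zero, abs_zero, ne_eq, OfNat.ofNat_ne_zero,
      not_false_eq_true, zero_pow, zero_div, Complex.exp_zero, one_pow, mul_one, zero_add] at h
    rwa [← Complex.ofReal_sub, Complex.norm_real, Real.norm_eq_abs] at h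

end LinRep

/-! ### Assembly: the dominant component and the normalisation. -/

/-- A quotient of perturbed weights satisfies the same local estimate. -/
theorem abs_quotient_sub_le {c G G₀ a a' S q ε₁ ε₂ ε₃ : ℝ} (hc : 0 < c) (hq : 0 ≤ q) (hG : 0 ≤ G)
    (hG₀ : G ≤ G₀) (hS : c / 2 ≤ S) (h1 : |q * a - c * G| ≤ ε₁) (ha' : 0 ≤ a')
    (h2 : q * a' ≤ ε₂) (h3 : |S - c| ≤ ε₃) :
    |q * ((a + a') / S) - G| ≤ 2 / c * (ε₁ + ε₂ + ε₃ * G₀) := by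
  have hS0 : 0 < S := by linarith
  have hid : q * ((a + a') / S) - G = ((q * a - c * G) + q * a' - (S - c) * G) / S := by
    field_simp
    ring
  have hnum : |(q * a - c * G) + q * a' - (S - c) * G| ≤ ε₁ + ε₂ + ε₃ * G₀ := by
    calc _ ≤ |q * a - c * G| + |q * a'| + |(S - c) * G| :=
          (abs_sub _ _).trans (by gcongr; exact abs_add_le _ _)
      _ ≤ _ := by
        rw [abs_of_nonneg (mul_nonneg hq ha'), abs_mul, abs_of_nonneg hG]
        gcongr
        exact (abs_nonneg _).trans h3
  have hnn : 0 ≤ ε₁ + ε₂ + ε₃ * G₀ := (abs_nonneg _).trans hnum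
  rw [hid, abs_div, abs_of_pos hS0, div_le_iff₀ hS0]
  refine hnum.trans ?_
  have : 1 ≤ 2 / c * S := by
    rw [div_mul_eq_mul_div, le_div_iff₀ hc]
    linarith
  nlinarith

theorem exists_pow_le_div {ρ : ℝ} (h0 : 0 < ρ) (h1 : ρ < 1) :
    ∃ D : ℝ, 0 ≤ D ∧ ∀ n : ℕ, 1 ≤ n → ρ ^ n ≤ D / n := by
  obtain ⟨D, hD⟩ := (tendsto_self_mul_const_pow_of_lt_one h0.le h1).bddAbove_range
  have hD' : ∀ n : ℕ, n * ρ ^ n ≤ D := fun n => hD ⟨n, rfl⟩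
  refine ⟨D, by simpa using hD' 0, fun n hn => ?_⟩
  have hn0 : (0 : ℝ) < n := by exact_mod_cast hn
  rw [le_div_iff₀ hn0, mul_comm]
  exact hD' n

end SymbolStat

open SymbolStat in
theorem mainTheorem7 (m₁ m₂ : ℕ) (R₁ : SymbolStat.LinRep (Fin m₁)) (R₂ : SymbolStat.LinRep (Fin m₂))
    (hmodel : SymbolStat.IsSumModel R₁ R₂)
    (hdom : R₂.perronValue < R₁.perronValue)
    (hprim : R₁.M.IsPrimitive)
    (haper : R₁.IsAperiodicPair) :
    (∃ u : ℂ → ℂ, R₁.IsPerronBranch u) ∧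
    ∀ u : ℂ → ℂ, R₁.IsPerronBranch u →
      ∃ β₁ γ₁ : ℝ,
        (β₁ : ℂ) = deriv u 0 / (R₁.perronValue : ℂ) ∧
        (γ₁ : ℂ) = iteratedDeriv 2 u 0 / (R₁.perronValue : ℂ)
          - (deriv u 0 / (R₁.perronValue : ℂ)) ^ 2 ∧
        0 < β₁ ∧ β₁ < 1 ∧ 0 < γ₁ ∧
        ∃ C : ℝ, ∃ N : ℕ, ∀ n : ℕ, N ≤ n → ∀ k : ℕ, k ≤ n →
          |Real.sqrt n * (R₁.sum R₂).prY n k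
              - Real.exp (-(((k : ℝ) - β₁ * n) ^ 2 / (2 * γ₁ * n))) / Real.sqrt (2 * Real.pi * γ₁)|
            ≤ C * (n : ℝ) ^ (-(1 / 2) : ℝ) := by
  obtain ⟨i₁, hi₁⟩ := Function.ne_iff.mp hmodel.ξ₁_ne_zero
  obtain ⟨j₁, hj₁⟩ := Function.ne_iff.mp hmodel.η₁_ne_zero
  obtain ⟨i₂, -⟩ := Function.ne_iff.mp hmodel.ξ₂_ne_zero
  have : Nonempty (Fin m₁) := ⟨i₁⟩
  have : Nonempty (Fin m₂) := ⟨i₂⟩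
  obtain ⟨hr, v, hv, p, hR⟩ := R₁.exists_isStochastic_rescale hprim haper
  set r := R₁.perronValue with hrdef
  have hrc : (r : ℂ) ≠ 0 := by exact_mod_cast hr.ne'
  set R := R₁.rescale hr hv with hRdef
  have htwist : ∀ (x z : ℂ), x • (1 : Matrix (Fin m₁) (Fin m₁) ℂ)
      - Complex.exp z • R₁.A.map (algebraMap ℝ ℂ) - R₁.B.map (algebraMap ℝ ℂ) =
        x • (1 : Matrix (Fin m₁) (Fin m₁) ℂ) - R₁.twist z := fun x z => by
    rw [LinRep.twist, sub_sub]
  refine ⟨?_, fun u hu => ?_⟩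
  · obtain ⟨u, hu, hu0, hdet⟩ := hR.exists_branch
    refine ⟨fun z => r * u z, analyticAt_const.mul hu, by simp [hu0, ← hrdef], ?_⟩
    filter_upwards [hdet] with z hz
    rw [htwist, ← R₁.det_rescale_eq_zero_iff hr hv, mul_div_cancel_left₀ _ hrc]
    exact hz
  -- An arbitrary branch `u` is transferred to the stochastic rescaling, where its derivatives are
  -- computed directly; no uniqueness of the branch is needed.
  set u' : ℂ → ℂ := fun z => u z / r with hu'
  have hua : AnalyticAt ℂ u' 0 := hu.analyticAt.div_const
  have hu0 : u' 0 = 1 := by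
    simp only [hu', hu.map_zero]
    exact div_self hrc
  have hdet : ∀ᶠ z in 𝓝 (0 : ℂ),
      (u' z • (1 : Matrix (Fin m₁) (Fin m₁) ℂ) - R.twist z).det = 0 := by
    filter_upwards [hu.det_eq_zero] with z hz
    rw [htwist] at hz
    exact (R₁.det_rescale_eq_zero_iff hr hv _ _).mpr hz
  obtain ⟨β, γ, hu1, hu2, hβ0, hβ1, hγ⟩ := hR.exists_mean_variance hua hu0 hdet
  have hd1 : deriv u 0 / (r : ℂ) = β := by rw [← hu1, hu', deriv_div_const]
  have hd2 : iteratedDeriv 2 u 0 / (r : ℂ) = γ + (β : ℂ) ^ 2 := by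
    rw [← hu2, hu', iteratedDeriv_div_const]
  refine ⟨β, γ, hd1.symm, by rw [hd2, hd1]; ring, hβ0, hβ1, hγ, ?_⟩
  have hξ : R.ξ ≠ 0 := fun h => (mul_ne_zero hi₁ (hv i₁).ne') (congrFun h i₁)
  have hη : R.η ≠ 0 := fun h => (mul_ne_zero (inv_ne_zero (hv j₁).ne') hj₁) (congrFun h j₁)
  obtain ⟨c, hc, ⟨C₁, hC₁, hloc⟩, K, ρ, hK, hρ0, hρ1, htot⟩ :=
    hR.exists_weight_bound hua hu0 hdet hγ hu1 hu2 hξ hη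
  obtain ⟨C₂, σ, hσ0, hσ1, hC₂, htot₂⟩ := R₂.exists_totalWeight_bound hdom
  obtain ⟨D₁, hD₁, hρD⟩ := exists_pow_le_div hρ0 hρ1
  obtain ⟨D₂, hD₂, hσD⟩ := exists_pow_le_div hσ0 hσ1
  set G₀ := 1 / Real.sqrt (2 * Real.pi * γ) with hG₀
  have hsmall : Tendsto (fun n : ℕ => K * ρ ^ n + C₂ * σ ^ n) atTop (𝓝 (K * 0 + C₂ * 0)) :=
    ((tendsto_pow_atTop_nhds_zero_of_lt_one hρ0.le hρ1).const_mul K).add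
      ((tendsto_pow_atTop_nhds_zero_of_lt_one hσ0.le hσ1).const_mul C₂)
  rw [mul_zero, mul_zero, add_zero] at hsmall
  obtain ⟨N, hN⟩ := eventually_atTop.mp (hsmall.eventually (ge_mem_nhds (half_pos hc)))
  -- The summands are the local error of the first component, the weight of the second, and the
  -- error of the total weight times `G₀`, the maximum of the Gaussian density. `N` keeps the total
  -- weight above `c / 2`, whence the factor `2 / c`.
  refine ⟨2 / c * (C₁ + C₂ * D₂ + (K * D₁ + C₂ * D₂) * G₀), max N 1, fun n hn k _ => ?_⟩
  have hn1 : 1 ≤ n := (le_max_right _ _).trans hn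
  have hn0 : (0 : ℝ) < n := by exact_mod_cast hn1
  have hn1' : (1 : ℝ) ≤ n := by exact_mod_cast hn1
  have hs0 : 0 < Real.sqrt n := Real.sqrt_pos.mpr hn0
  have hss : Real.sqrt n * Real.sqrt n = n := Real.mul_self_sqrt hn0.le
  have hs1 : 1 ≤ Real.sqrt n := Real.one_le_sqrt.mpr hn1'
  have hrn : (r ^ n)⁻¹ ≠ 0 := inv_ne_zero (pow_pos hr n).ne'
  have hprY : (R₁.sum R₂).prY n k = (R.weight n k + (r ^ n)⁻¹ * R₂.weight n k) /
      (R.totalWeight n + (r ^ n)⁻¹ * R₂.totalWeight n) := by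
    rw [LinRep.prY_eq, weight_sum, totalWeight_sum, hRdef, LinRep.rescale_weight,
      LinRep.rescale_totalWeight, ← mul_add, ← mul_add, mul_div_mul_left _ _ hrn]
  have hw₂ : 0 ≤ (r ^ n)⁻¹ * R₂.weight n k :=
    mul_nonneg (inv_nonneg.mpr (pow_pos hr n).le) (R₂.weight_nonneg n k)
  have hwt₂ : (r ^ n)⁻¹ * R₂.weight n k ≤ (r ^ n)⁻¹ * R₂.totalWeight n :=
    mul_le_mul_of_nonneg_left (R₂.weight_le_totalWeight n k) (inv_nonneg.mpr (pow_pos hr n).le)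
  have hS : |R.totalWeight n + (r ^ n)⁻¹ * R₂.totalWeight n - c| ≤ K * ρ ^ n + C₂ * σ ^ n := by
    rw [add_sub_right_comm]
    refine (abs_add_le _ _).trans (add_le_add (htot n hn1) ?_)
    rw [abs_of_nonneg (hw₂.trans hwt₂)]
    exact htot₂ n
  have hS2 : c / 2 ≤ R.totalWeight n + (r ^ n)⁻¹ * R₂.totalWeight n := by
    have h1 := hN n ((le_max_left _ _).trans hn)
    have h2 := (abs_le.mp (hS.trans h1)).1
    linarith
  have hinv : 1 / (n : ℝ) ≤ 1 / Real.sqrt n :=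
    one_div_le_one_div_of_le hs0 (by nlinarith)
  have hS3 : K * ρ ^ n + C₂ * σ ^ n ≤ (K * D₁ + C₂ * D₂) / Real.sqrt n := by
    calc K * ρ ^ n + C₂ * σ ^ n ≤ K * (D₁ / n) + C₂ * (D₂ / n) := by
          gcongr
          · exact hρD n hn1
          · exact hσD n hn1
      _ = (K * D₁ + C₂ * D₂) * (1 / n) := by ring
      _ ≤ (K * D₁ + C₂ * D₂) * (1 / Real.sqrt n) := by gcongr
      _ = _ := by ring
  have h2 : Real.sqrt n * ((r ^ n)⁻¹ * R₂.weight n k) ≤ C₂ * D₂ / Real.sqrt n := by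
    calc _ ≤ Real.sqrt n * (C₂ * (D₂ / n)) := mul_le_mul_of_nonneg_left
          ((hwt₂.trans (htot₂ n)).trans (mul_le_mul_of_nonneg_left (hσD n hn1) hC₂)) hs0.le
      _ = C₂ * D₂ * (Real.sqrt n / n) := by ring
      _ = C₂ * D₂ * (1 / Real.sqrt n) := by
        congr 1
        rw [div_eq_div_iff hn0.ne' hs0.ne', hss, one_mul]
      _ = _ := by ring
  have hG1 : Real.exp (-(((k : ℝ) - β * n) ^ 2 / (2 * γ * n))) ≤ 1 := by
    rw [Real.exp_le_one_iff, neg_nonpos]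
    positivity
  have hfin := abs_quotient_sub_le (G₀ := G₀) hc hs0.le (by positivity)
    (by rw [hG₀]; gcongr) hS2 (hloc n hn1 k) hw₂ h2 (hS.trans hS3)
  rw [hprY, Real.rpow_neg hn0.le, ← Real.sqrt_eq_rpow]
  refine hfin.trans (le_of_eq ?_)
  ring
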